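/- For a multiplicative semigroup $S$, the Erdős–Burgess constant $I(S)$ is the smallest positive integer $m$ such that every sequence of $m$ (not necessarily distinct) elements of $S$ has a nonempty subsequence whose elements, multiplied in order, give an idempotent of $S$ (an $x$ with $x^2=x$); $I(S)=\infty$ if no such $m$ exists. For a finite abelian group $G$, the Davenport constant $\mathsf D(G)$ is the smallest positive integer $m$ such that every sequence of $m$ elements of $G$ has a nonempty subsequence whose product (in $G$ written multiplicatively) is the identity. For $n\ge 1$, let $\Omega(n)$ and $\omega(n)$ be the numbers of prime factors of $n$ counted with and without multiplicity, and let $I_r(\mathbb Z/n\mathbb Z)$ be the Erdős–Burgess constant of the multiplicative semigroup of $\mathbb Z/n\mathbb Z$. **Theorem.** Let $n=p^kq^\ell$, where $p,q$ are distinct primes and $k,\ell\ge 1$ are integers. Then $$I_r(\mathbb Z/n\mathbb Z)=\mathsf D\big((\mathbb Z/n\mathbb Z)^\times\big)+(k-1)+(\ell-1).$$ Consequently, $I_r(\mathbb Z/n\mathbb Z)=\mathsf D\big((\mathbb Z/n\mathbb Z)^\times\big)+\Omega(n)-\omega(n)$ (the equality conjectured by Hao, Wang and Zhang for all $n>1$)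 holds for every positive integer $n$ with exactly two distinct prime factors. -/

import Mathlib

/-- `IsErdosBurgessLength S k`: every sequence of `k` (not necessarily distinct) elements of the
multiplicative semigroup `S` has a nonempty subsequence (in the same relative order) whose elements
multiply to an idempotent.  The nonempty subsequence is written `a :: l`, and its product
`(((a * l₀) * l₁) * ⋯)` is the left fold, since `S` need not have an identity. -/
def IsErdosBurgessLength (S : Type*) [Semigroup S] (k : ℕ) : Prop :=
  ∀ L : List S, L.length = k →
    ∃ (a : S) (l : List S), (a :: l).Sublist L ∧ IsIdempotentElem (l.foldl (fun x y => x * y) a)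

/-- The Erdős–Burgess constant `I(S)`: the smallest positive integer `k` such that every sequence
of `k` elements of `S` has a nonempty subsequence with idempotent product, and `∞` if there is no
such `k` (the infimum of the empty set in `ℕ∞` is `⊤`). -/
noncomputable def erdosBurgess (S : Type*) [Semigroup S] : ℕ∞ :=
  sInf {x : ℕ∞ | ∃ k : ℕ, 0 < k ∧ IsErdosBurgessLength S k ∧ x = (k : ℕ∞)}

/-- `IsDavenportLength G k`: every sequence of `k` elements of the abelian group `G` (written
multiplicatively) has a nonempty subsequence whose product is the identity. -/
def IsDavenportLength (G : Type*) [CommGroup G] (k : ℕ) : Prop :=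
  ∀ L : List G, L.length = k → ∃ T : List G, T ≠ [] ∧ T.Sublist L ∧ T.prod = 1

/-- The Davenport constant `D(G)` of a finite abelian group `G` (written multiplicatively): the
smallest positive integer `k` such that every sequence of `k` elements of `G` has a nonempty
subsequence whose product is the identity.  See `davenport_isLeast`: for finite `G` this minimum
exists, so no default value is involved. -/
noncomputable def davenport (G : Type*) [CommGroup G] [Finite G] : ℕ :=
  sInf {k : ℕ | 0 < k ∧ IsDavenportLength G k}

/-- In a monoid, the defining property of `IsErdosBurgessLength` in terms of `List.prod`. -/
theorem isErdosBurgessLength_iff (S : Type*) [Monoid S] (k : ℕ) :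
    IsErdosBurgessLength S k ↔ ∀ L : List S, L.length = k →
      ∃ T : List S, T ≠ [] ∧ T.Sublist L ∧ IsIdempotentElem T.prod := by
  have key : ∀ (l : List S) (a : S), l.foldl (fun x y => x * y) a = (a :: l).prod := by
    intro l
    induction l with
    | nil => intro a; simp
    | cons b l ih => intro a; rw [List.foldl_cons, ih]; simp [mul_assoc]
  refine forall_congr' fun L => imp_congr_right fun _ => ⟨?_, ?_⟩
  · rintro ⟨a, l, h, hi⟩
    exact ⟨a :: l, by simp, h, key l a ▸ hi⟩
  · rintro ⟨T, hT, h, hi⟩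
    cases T with
    | nil => exact absurd rfl hT
    | cons a l => exact ⟨a, l, h, (key l a).symm ▸ hi⟩

/-- For a finite abelian group the minimum that defines the Davenport constant is attained. -/
theorem davenport_isLeast (G : Type*) [CommGroup G] [Finite G] :
    IsLeast {k : ℕ | 0 < k ∧ IsDavenportLength G k} (davenport G) := by
  have hne : {k : ℕ | 0 < k ∧ IsDavenportLength G k}.Nonempty := by
    refine ⟨Nat.card G, Nat.card_pos, fun L hL => ?_⟩
    have hninj : ¬ Function.Injective (fun i : Fin (Nat.card G + 1) => (L.take i).prod) := by
      intro hinj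
      have := Nat.card_le_card_of_injective _ hinj
      simp at this
    have hex : ∃ i j : Fin (Nat.card G + 1), i < j ∧ (L.take i).prod = (L.take j).prod := by
      simp only [Function.Injective, not_forall] at hninj
      obtain ⟨i, j, hij, hne⟩ := hninj
      rcases lt_or_gt_of_ne hne with h | h
      · exact ⟨i, j, h, hij⟩
      · exact ⟨j, i, h, hij.symm⟩
    obtain ⟨i, j, hij, hprod⟩ := hex
    have hij' : (i : ℕ) < j := hij
    have hj := j.2
    refine ⟨(L.take j).drop i, ?_, (List.drop_sublist _ _).trans (List.take_sublist _ _), ?_⟩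
    · intro h
      have := congrArg List.length h
      simp at this
      omega
    · have h1 := List.prod_take_mul_prod_drop (L.take j) i
      rw [List.take_take, min_eq_left hij'.le, hprod] at h1
      simpa using h1
  exact ⟨Nat.sInf_mem hne, fun k hk => Nat.sInf_le hk⟩

/-! Lower bound: take D - 1 units with no nonempty subproduct 1, then k - 1 copies of an element
that is p modulo p^k and 1 modulo q^l, and l - 1 copies of its counterpart. Each factor is local, so
an idempotent subproduct can use none of the extra elements, and a unit idempotent is 1.

Upper bound: if at least k terms are divisible by p and at least l by q, the product of all nonunits
is 0. Otherwise, say with fewer than l terms divisible by q, the units A and the nonunits prime to q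
together number at least D + k - 1. It suffices to find k or more of these nonunits and some units
with product 1 modulo q^l, since that product is 0 modulo p^k. This is `exists_long_prod`, applied
to reduction of units modulo q^l.

There, let Q be the quotient by the stabilizer of the set of subset products of the image of A. An
element of B either enlarges the current set of products or can be used for free, so the number of
enlargements must be bounded. On the other side, elements of A in the kernel together with lifts of
a product-one free sequence of Q bound D from below. For cyclic Q both counts involve |Q| - 1.
Noncyclic Q occurs only for q = 2; it is generated by an involution and an element of order 2^j. If
the image of A outside the kernel is product-one free, Olson's group algebra argument replaces
counting, because the (2^j + 1)st power of the augmentation ideal over ZMod 2 vanishes. If not, the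
lower bound for D improves by one, and this pays for the chain bound 2^j + 1 of
`StrictChain.length_le_two_pow_add_one`, which rests on `card_le_two_pow_of_aperiodic`. -/

open scoped Pointwise

/-! ### Subset products, aperiodic sets and strict chains -/

section SubsetProducts

variable {G H : Type*} [CommGroup G] [DecidableEq G] [CommGroup H] [DecidableEq H]

/-- The products of all (possibly empty) sub-multisets of `S`. -/
def subsetProds (S : Multiset G) : Finset G :=
  (S.powerset.map Multiset.prod).toFinset

theorem mem_subsetProds {S : Multiset G} {g : G} :
    g ∈ subsetProds S ↔ ∃ T ≤ S, T.prod = g := by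
  simp [subsetProds]

theorem one_mem_subsetProds (S : Multiset G) : 1 ∈ subsetProds S :=
  mem_subsetProds.2 ⟨0, by simp, by simp⟩

theorem subsetProds_zero : subsetProds (0 : Multiset G) = 1 := by
  ext g
  simp [mem_subsetProds, eq_comm]

theorem subsetProds_cons (a : G) (S : Multiset G) :
    subsetProds (a ::ₘ S) = {1, a} * subsetProds S := by
  ext g
  simp only [subsetProds, Multiset.powerset_cons, Multiset.map_add, Multiset.map_map,
    Multiset.toFinset_add, Finset.mem_union, Multiset.mem_toFinset, Finset.mem_mul,
    Multiset.mem_map, Function.comp_apply, Multiset.prod_cons]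
  constructor
  · rintro (⟨T, hT, rfl⟩ | ⟨T, hT, rfl⟩)
    · exact ⟨1, by simp, _, ⟨T, hT, rfl⟩, by simp⟩
    · exact ⟨a, by simp, _, ⟨T, hT, rfl⟩, rfl⟩
  · rintro ⟨y, hy, _, ⟨T, hT, rfl⟩, rfl⟩
    rcases Finset.mem_insert.1 hy with rfl | hy
    · exact Or.inl ⟨T, hT, by simp⟩
    · rw [Finset.mem_singleton.1 hy]
      exact Or.inr ⟨T, hT, rfl⟩

theorem subsetProds_add (S T : Multiset G) :
    subsetProds (S + T) = subsetProds S * subsetProds T := by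
  induction S using Multiset.induction with
  | empty => simp [subsetProds_zero]
  | cons a S ih => rw [Multiset.cons_add, subsetProds_cons, ih, subsetProds_cons, mul_assoc]

theorem subsetProds_map (f : G →* H) (S : Multiset G) :
    subsetProds (S.map f) = (subsetProds S).image f := by
  induction S using Multiset.induction with
  | empty => simp [subsetProds_zero, ← Finset.singleton_one]
  | cons a S ih =>
    rw [Multiset.map_cons, subsetProds_cons, ih, subsetProds_cons, Finset.image_mul]
    simp [Finset.image_insert]

theorem subsetProds_subset_subgroup {S : Multiset G} {M : Subgroup G} (h : ∀ g ∈ S, g ∈ M) {g : G}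
    (hg : g ∈ subsetProds S) : g ∈ M := by
  obtain ⟨T, hT, rfl⟩ := mem_subsetProds.1 hg
  exact Subgroup.multiset_prod_mem _ _ fun x hx => h x (Multiset.mem_of_le hT hx)

/-- `X` is not a union of cosets of a nontrivial subgroup. -/
def Aperiodic (X : Finset G) : Prop := ∀ g : G, g • X = X → g = 1

theorem Aperiodic.of_mul {X Y : Finset G} (h : Aperiodic (X * Y)) : Aperiodic X := by
  intro g hg
  exact h g (by rw [← smul_mul_assoc, hg])

theorem Aperiodic.subsetProds_of_le {S T : Multiset G} (h : Aperiodic (subsetProds T))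
    (hST : S ≤ T) : Aperiodic (subsetProds S) := by
  obtain ⟨U, rfl⟩ := Multiset.le_iff_exists_add.1 hST
  rw [subsetProds_add] at h
  exact h.of_mul

theorem smul_eq_self_of_subset {X : Finset G} {g : G} (h : g • X ⊆ X) : g • X = X :=
  Finset.eq_of_subset_of_card_le h (by simp)

theorem pair_mul (g : G) (X : Finset G) : ({1, g} : Finset G) * X = X ∪ g • X := by
  rw [Finset.insert_eq, Finset.union_mul, Finset.singleton_mul, Finset.singleton_mul]
  simp [Finset.smul_finset_def]

/-- Multiplying `X` by `{1, b}` for the successive elements `b` of the list gives a strictly larger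
set at every step. -/
def StrictChain : Finset G → List G → Prop
  | _, [] => True
  | X, b :: R => b • X ≠ X ∧ StrictChain ({1, b} * X) R

theorem StrictChain.card_add_le {R : List G} : ∀ {X : Finset G}, StrictChain X R →
    R.length + X.card ≤ (X * subsetProds (R : Multiset G)).card := by
  induction R with
  | nil => intro X _; simp [subsetProds_zero]
  | cons b R ih =>
    intro X h
    have h1 := ih h.2
    have h2 : X.card < (({1, b} : Finset G) * X).card := by
      rw [pair_mul]
      apply Finset.card_lt_card
      refine Finset.ssubset_iff_subset_ne.2 ⟨Finset.subset_union_left, fun h3 => h.1 ?_⟩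
      exact smul_eq_self_of_subset (Finset.union_eq_left.1 h3.symm)
    rw [← Multiset.cons_coe, subsetProds_cons, mul_left_comm, ← mul_assoc]
    simp only [List.length_cons]
    omega

theorem strictChain_append {R S : List G} : ∀ {X : Finset G}, StrictChain X (R ++ S) ↔
    StrictChain X R ∧ StrictChain (X * subsetProds (R : Multiset G)) S := by
  induction R with
  | nil => intro X; simp [subsetProds_zero, StrictChain]
  | cons b R ih =>
    intro X
    rw [List.cons_append, StrictChain, StrictChain, ih, and_assoc, ← Multiset.cons_coe,
      subsetProds_cons, mul_left_comm, ← mul_assoc]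

/-- An element that fixes `X` fixes `X * Y`, so discarding factors preserves strictness; `Y`
collects the discarded ones during the induction. -/
theorem StrictChain.sublist {R S : List G} (hRS : R.Sublist S) : ∀ {X Y : Finset G},
    StrictChain (X * Y) S → StrictChain X R := by
  induction hRS with
  | slnil => intro X Y _; trivial
  | cons a _ ih =>
    intro X Y h
    have h2 := h.2
    rw [mul_left_comm] at h2
    exact ih h2
  | cons_cons a _ ih =>
    intro X Y h
    have h2 := h.2
    rw [← mul_assoc] at h2
    exact ⟨fun h3 => h.1 (by rw [← smul_mul_assoc, h3]), ih h2⟩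

/-- An element fixing a partial product would fix the full product, which only 1 does. -/
theorem strictChain_of_aperiodic {R : List G} : ∀ {X : Finset G}, (∀ g ∈ R, g ≠ 1) →
    Aperiodic (X * subsetProds (R : Multiset G)) → StrictChain X R := by
  induction R with
  | nil => intro X _ _; trivial
  | cons b R ih =>
    intro X h1 h
    refine ⟨fun h2 => h1 b (by simp) (h.of_mul b h2), ih (fun g hg => h1 g (by simp [hg])) ?_⟩
    rwa [← Multiset.cons_coe, subsetProds_cons, mul_left_comm, ← mul_assoc] at h

theorem StrictChain.ne_one {R : List G} : ∀ {X : Finset G}, StrictChain X R → ∀ g ∈ R, g ≠ 1 := by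
  induction R with
  | nil => intro X _; simp
  | cons b R ih =>
    intro X h g hg
    rcases List.mem_cons.1 hg with rfl | hg
    · rintro rfl
      exact h.1 (one_smul _ _)
    · exact ih h.2 g hg

theorem card_lt_card_subsetProds_of_aperiodic {S : Multiset G} (h1 : ∀ g ∈ S, g ≠ 1)
    (h : Aperiodic (subsetProds S)) : S.card + 1 ≤ (subsetProds S).card := by
  have := (strictChain_of_aperiodic (R := S.toList) (X := 1) (by simpa using h1)
    (by simpa using h)).card_add_le
  simpa using this

/-- Either an element of `B` enlarges `X` or it can be used for free: greedily, `B` splits into a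
strict chain and a part whose product is the inverse of an element of `X`. -/
theorem exists_strictChain_and_prod_inv_mem (B : Multiset G) : ∀ X : Finset G, 1 ∈ X →
    ∃ (R : List G) (T : Multiset G), StrictChain X R ∧ T ≤ B ∧ B.card ≤ T.card + R.length ∧
      T.prod⁻¹ ∈ X := by
  induction B using Multiset.induction with
  | empty => intro X hX; exact ⟨[], 0, trivial, le_rfl, by simp, by simpa using hX⟩
  | cons b B ih =>
    intro X hX
    by_cases hb : b • X = X
    · obtain ⟨R, T, h1, h2, h3, h4⟩ := ih X hX
      refine ⟨R, b ::ₘ T, h1, Multiset.cons_le_cons b h2, ?_, ?_⟩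
      · simp only [Multiset.card_cons]; omega
      · have h5 : b⁻¹ • X = X := by rw [inv_smul_eq_iff, hb]
        rw [Multiset.prod_cons, mul_inv, ← smul_eq_mul, ← h5]
        exact Finset.smul_mem_smul_finset h4
    · obtain ⟨R, T, h1, h2, h3, h4⟩ := ih ({1, b} * X) (by
        rw [pair_mul]; exact Finset.mem_union_left _ hX)
      rw [pair_mul, Finset.mem_union] at h4
      rcases h4 with h4 | h4
      · refine ⟨b :: R, T, ⟨hb, h1⟩, h2.trans (Multiset.le_cons_self _ _), ?_, h4⟩
        simp only [Multiset.card_cons, List.length_cons]; omega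
      · refine ⟨b :: R, b ::ₘ T, ⟨hb, h1⟩, Multiset.cons_le_cons b h2, ?_, ?_⟩
        · simp only [Multiset.card_cons, List.length_cons]; omega
        · rw [← Finset.inv_smul_mem_iff] at h4
          simpa [mul_comm] using h4

end SubsetProducts

/-! ### Reduction modulo the stabilizer -/

section Stabilizer

variable {G : Type*} [CommGroup G] [DecidableEq G]

theorem mk_mem_stabilizer_iff {X : Finset G} {g : G} :
    g ∈ MulAction.stabilizer G X ↔ g • X = X := Iff.rfl

/-- The images, modulo the stabilizer of the set of products, of the elements outside of it. -/
noncomputable def aperiodicPart (S : Multiset G) :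
    Multiset (G ⧸ MulAction.stabilizer G (subsetProds S)) :=
  open Classical in
  (S.filter (· ∉ MulAction.stabilizer G (subsetProds S))).map (QuotientGroup.mk' _)

theorem ne_one_of_mem_aperiodicPart (S : Multiset G) : ∀ q ∈ aperiodicPart S, q ≠ 1 := by
  intro q hq
  simp only [aperiodicPart, Multiset.mem_map, Multiset.mem_filter] at hq
  obtain ⟨g, ⟨-, hg⟩, rfl⟩ := hq
  rwa [ne_eq, QuotientGroup.mk'_apply, QuotientGroup.eq_one_iff]

theorem subsetProds_map_mk_filter (M : Subgroup G) [DecidableEq (G ⧸ M)] [DecidablePred (· ∈ M)]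
    (S : Multiset G) : subsetProds ((S.filter (· ∉ M)).map (QuotientGroup.mk' M)) =
      (subsetProds S).image (QuotientGroup.mk' M) := by
  have h := Multiset.filter_add_not (· ∈ M) S
  conv_rhs => rw [← subsetProds_map, ← h, Multiset.map_add, subsetProds_add]
  convert (one_mul _).symm
  ext q
  simp only [Finset.mem_one]
  constructor
  · intro hq
    have := subsetProds_subset_subgroup (M := ⊥) (by
      intro g hg
      simp only [Multiset.mem_map, Multiset.mem_filter] at hg
      obtain ⟨g, ⟨-, hg⟩, rfl⟩ := hg
      rwa [Subgroup.mem_bot, QuotientGroup.mk'_apply, QuotientGroup.eq_one_iff]) hq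
    simpa using this
  · rintro rfl
    exact one_mem_subsetProds _

variable (S : Multiset G) [DecidableEq (G ⧸ MulAction.stabilizer G (subsetProds S))]

theorem subsetProds_aperiodicPart : subsetProds (aperiodicPart S) =
    (subsetProds S).image (QuotientGroup.mk' (MulAction.stabilizer G (subsetProds S))) := by
  classical
  rw [← subsetProds_map_mk_filter, aperiodicPart]

/-- A set is a union of cosets of its stabilizer, so passing to the quotient loses no information
about membership. -/
theorem mk_mem_subsetProds_aperiodicPart {g : G} :
    QuotientGroup.mk' _ g ∈ subsetProds (aperiodicPart S) ↔ g ∈ subsetProds S := by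
  rw [subsetProds_aperiodicPart, Finset.mem_image]
  constructor
  · rintro ⟨x, hx, h⟩
    have h1 := QuotientGroup.eq.1 h
    rw [mk_mem_stabilizer_iff] at h1
    rw [← h1]
    rw [← Finset.inv_smul_mem_iff]
    simpa using hx
  · exact fun h => ⟨g, h, rfl⟩

theorem aperiodic_aperiodicPart : Aperiodic (subsetProds (aperiodicPart S)) := by
  intro q
  induction q using QuotientGroup.induction_on with
  | H g =>
    intro h
    rw [QuotientGroup.eq_one_iff, mk_mem_stabilizer_iff]
    apply smul_eq_self_of_subset
    intro x hx
    rw [← Finset.inv_smul_mem_iff, smul_eq_mul, ← mk_mem_subsetProds_aperiodicPart] at hx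
    rw [← mk_mem_subsetProds_aperiodicPart, ← h, ← Finset.inv_smul_mem_iff]
    simpa using hx

end Stabilizer

/-! ### The binary group algebra and Olson's coefficient argument -/

section GroupAlgebra

/-- The group algebra over the field with two elements. -/
abbrev BinaryGroupAlgebra (Q : Type*) [CommGroup Q] := MonoidAlgebra (ZMod 2) Q

/-- The element `1 - g` of the group algebra. -/
noncomputable def oneSub {Q : Type*} [CommGroup Q] (g : Q) : BinaryGroupAlgebra Q :=
  1 - MonoidAlgebra.of (ZMod 2) Q g

variable {Q : Type*} [CommGroup Q]

instance : CharP (BinaryGroupAlgebra Q) 2 :=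
  charP_of_injective_algebraMap (FaithfulSMul.algebraMap_injective (ZMod 2) _) 2

theorem oneSub_mul (g h : Q) : oneSub (g * h) = oneSub g + oneSub h - oneSub g * oneSub h := by
  simp only [oneSub, map_mul]
  ring

theorem oneSub_one : oneSub (1 : Q) = 0 := by
  simp only [oneSub, map_one, sub_self]

theorem oneSub_inv (g : Q) : oneSub g⁻¹ = -MonoidAlgebra.of (ZMod 2) Q g⁻¹ * oneSub g := by
  have h : MonoidAlgebra.of (ZMod 2) Q g⁻¹ * MonoidAlgebra.of (ZMod 2) Q g = 1 := by
    rw [← map_mul, inv_mul_cancel, map_one]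
  simp only [oneSub]
  linear_combination -h

/-- The elements of `Q` congruent to `1` modulo an ideal of the group algebra. -/
def congruenceSubgroup (J : Ideal (BinaryGroupAlgebra Q)) : Subgroup Q where
  carrier := {g | oneSub g ∈ J}
  mul_mem' {g h} hg hh := by
    rw [Set.mem_ofPred_eq, oneSub_mul]
    exact sub_mem (add_mem hg hh) (J.mul_mem_left _ hh)
  one_mem' := by
    rw [Set.mem_ofPred_eq, oneSub_one]
    exact J.zero_mem
  inv_mem' {g} hg := by
    rw [Set.mem_ofPred_eq, oneSub_inv]
    exact J.mul_mem_left _ hg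

theorem mem_congruenceSubgroup {J : Ideal (BinaryGroupAlgebra Q)} {g : Q} :
    g ∈ congruenceSubgroup J ↔ oneSub g ∈ J := Iff.rfl

theorem oneSub_pow_two_pow (g : Q) (n : ℕ) : oneSub g ^ 2 ^ n = oneSub (g ^ 2 ^ n) := by
  simp only [oneSub, map_pow]
  rw [sub_pow_char_pow, one_pow]

theorem coeff_of [DecidableEq Q] (g h : Q) :
    (MonoidAlgebra.of (ZMod 2) Q g).coeff h = if g = h then 1 else 0 := by
  simp [Finsupp.single_apply]

theorem coeff_mul_of (z : BinaryGroupAlgebra Q) (g h : Q) :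
    (z * MonoidAlgebra.of (ZMod 2) Q g).coeff h = z.coeff (h * g⁻¹) := by
  simp

/-- If `I` is an ideal containing all `1 - g` and `I ^ (N + 1) = 0`, then an element of `I ^ d` with
nonzero coefficient at `1` has a nonzero coefficient at the inverse of a long product. -/
theorem exists_coeff_prod_inv_ne_zero {I : Ideal (BinaryGroupAlgebra Q)} {N : ℕ}
    (hI : ∀ g : Q, oneSub g ∈ I) (hN : I ^ (N + 1) = ⊥) (B : Multiset Q) :
    ∀ (z : BinaryGroupAlgebra Q) (d k : ℕ), z ∈ I ^ d → z.coeff 1 ≠ 0 → N + k ≤ d + B.card →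
      ∃ T ≤ B, k ≤ T.card ∧ z.coeff T.prod⁻¹ ≠ 0 := by
  induction B using Multiset.induction with
  | empty =>
    intro z d k hz h1 hk
    rcases Nat.eq_zero_or_pos k with rfl | hk0
    · exact ⟨0, le_rfl, by simp, by simpa using h1⟩
    · have h2 : z ∈ I ^ (N + 1) := Ideal.pow_le_pow_right (by simp at hk; omega) hz
      rw [hN, Ideal.mem_bot] at h2
      simp [h2] at h1
  | cons b B ih =>
    intro z d k hz h1 hk
    rcases Nat.eq_zero_or_pos k with rfl | hk0
    · exact ⟨0, Multiset.zero_le _, by simp, by simpa using h1⟩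
    rw [Multiset.card_cons] at hk
    have hcoeff : ∀ h, (z * oneSub b).coeff h = z.coeff h - z.coeff (h * b⁻¹) := by
      intro h
      rw [oneSub, mul_sub, mul_one, MonoidAlgebra.coeff_sub, Finsupp.sub_apply, coeff_mul_of]
    -- Either `z * b` keeps a nonzero coefficient at 1 and `b` joins `T`, or `z * (1 - b)` does and
    -- lies one power of `I` deeper, which can happen only until depth `N`.
    by_cases hb : (z * oneSub b).coeff 1 = 0
    · have h2 : (z * MonoidAlgebra.of (ZMod 2) Q b).coeff 1 ≠ 0 := by
        rw [hcoeff, sub_eq_zero] at hb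
        rwa [coeff_mul_of, ← hb]
      obtain ⟨T, hT, hTk, h3⟩ := ih _ d (k - 1) (Ideal.mul_mem_right _ _ hz) h2 (by omega)
      refine ⟨b ::ₘ T, Multiset.cons_le_cons b hT, by rw [Multiset.card_cons]; omega, ?_⟩
      rw [coeff_mul_of] at h3
      rwa [Multiset.prod_cons, mul_inv, mul_comm]
    · obtain ⟨T, hT, hTk, h3⟩ := ih _ (d + 1) k
        (by rw [pow_succ]; exact Ideal.mul_mem_mul hz (hI b)) hb (by omega)
      rw [hcoeff] at h3
      by_cases h4 : z.coeff T.prod⁻¹ = 0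
      · refine ⟨b ::ₘ T, Multiset.cons_le_cons b hT, by rw [Multiset.card_cons]; omega, ?_⟩
        rw [h4, zero_sub, neg_ne_zero] at h3
        rwa [Multiset.prod_cons, mul_inv, mul_comm]
      · exact ⟨T, hT.trans (Multiset.le_cons_self _ _), hTk, h4⟩

theorem prod_oneSub_mem_pow {I : Ideal (BinaryGroupAlgebra Q)} (hI : ∀ g : Q, oneSub g ∈ I)
    (S : Multiset Q) : (S.map oneSub).prod ∈ I ^ S.card := by
  induction S using Multiset.induction with
  | empty => simp
  | cons b S ih =>
    rw [Multiset.map_cons, Multiset.prod_cons, Multiset.card_cons, pow_succ']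
    exact Ideal.mul_mem_mul (hI b) ih

theorem coeff_prod_oneSub_eq_zero [DecidableEq Q] (S : Multiset Q) :
    ∀ g ∉ subsetProds S, ((S.map oneSub).prod : BinaryGroupAlgebra Q).coeff g = 0 := by
  induction S using Multiset.induction with
  | empty =>
    intro g hg
    rw [subsetProds_zero, Finset.mem_one] at hg
    rw [Multiset.map_zero, Multiset.prod_zero, ← map_one (MonoidAlgebra.of (ZMod 2) Q), coeff_of,
      if_neg (Ne.symm hg)]
  | cons b S ih =>
    intro g hg
    rw [subsetProds_cons, pair_mul, Finset.mem_union, not_or, ← Finset.inv_smul_mem_iff] at hg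
    rw [Multiset.map_cons, Multiset.prod_cons, mul_comm, oneSub, mul_sub, mul_one,
      MonoidAlgebra.coeff_sub, Finsupp.sub_apply, coeff_mul_of, ih g hg.1, ih _ (by
        rw [mul_comm]; exact hg.2), sub_zero]

/-- Only the empty sub-multiset contributes to the coefficient at 1 in the expanded product. -/
theorem coeff_one_prod_oneSub [DecidableEq Q] (S : Multiset Q)
    (hS : ∀ T ≤ S, T.prod = 1 → T = 0) :
    ((S.map oneSub).prod : BinaryGroupAlgebra Q).coeff 1 = 1 := by
  induction S using Multiset.induction with
  | empty =>
    rw [Multiset.map_zero, Multiset.prod_zero, ← map_one (MonoidAlgebra.of (ZMod 2) Q), coeff_of,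
      if_pos rfl]
  | cons b S ih =>
    have h : b⁻¹ ∉ subsetProds S := by
      intro h
      obtain ⟨T, hT, h1⟩ := mem_subsetProds.1 h
      have := hS (b ::ₘ T) (Multiset.cons_le_cons b hT) (by
        rw [Multiset.prod_cons, h1, mul_inv_cancel])
      simp at this
    rw [Multiset.map_cons, Multiset.prod_cons, mul_comm, oneSub, mul_sub, mul_one,
      MonoidAlgebra.coeff_sub, Finsupp.sub_apply, coeff_mul_of, one_mul,
      coeff_prod_oneSub_eq_zero S _ h, sub_zero,
      ih fun T hT => hS T (hT.trans (Multiset.le_cons_self _ _))]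

end GroupAlgebra

/-! ### Ideal powers and spanning for two generators -/

section TwoGenerators

variable {Q : Type*} [CommGroup Q] (e ε : Q)

/-- The ideal of the group algebra generated by `1 - ε` and `1 - e`. -/
noncomputable def generatorIdeal : Ideal (BinaryGroupAlgebra Q) :=
  Ideal.span {oneSub ε, oneSub e}

variable {e ε}

theorem oneSub_mem_generatorIdeal (hgen : ∀ q : Q, ∃ c m : ℕ, q = ε ^ c * e ^ m) (g : Q) :
    oneSub g ∈ generatorIdeal e ε := by
  rw [← mem_congruenceSubgroup]
  obtain ⟨c, m, rfl⟩ := hgen g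
  have hε : ε ∈ congruenceSubgroup (generatorIdeal e ε) := Ideal.subset_span (Or.inl rfl)
  have he : e ∈ congruenceSubgroup (generatorIdeal e ε) := Ideal.subset_span (Or.inr rfl)
  exact mul_mem (pow_mem hε _) (pow_mem he _)

theorem oneSub_mul_self (hε : ε ^ 2 = 1) : oneSub ε * oneSub ε = 0 := by
  have := oneSub_pow_two_pow ε 1
  rw [pow_one, hε, oneSub_one] at this
  rw [← sq, this]

/-- Since (1 - ε)² = 0, monomials with two or more factors 1 - ε vanish. -/
theorem generatorIdeal_pow_succ_le (hε : ε ^ 2 = 1) (a : ℕ) :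
    generatorIdeal e ε ^ (a + 1) ≤
      Ideal.span {oneSub e ^ (a + 1), oneSub ε * oneSub e ^ a} := by
  induction a with
  | zero =>
    rw [zero_add, pow_one, pow_one, pow_zero, mul_one, generatorIdeal, Set.pair_comm]
  | succ a ih =>
    rw [pow_succ]
    refine (Ideal.mul_mono_left ih).trans ?_
    rw [generatorIdeal, Ideal.span_mul_span', Ideal.span_le]
    have hx := oneSub_mul_self hε
    rintro _ ⟨u, hu, v, hv, rfl⟩
    rw [SetLike.mem_coe]
    rcases hu with rfl | rfl <;> rcases hv with rfl | rfl
    · exact Ideal.subset_span (Or.inr (mul_comm _ _))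
    · exact Ideal.subset_span (Or.inl (by simp only [pow_succ]))
    · have : oneSub ε * oneSub e ^ a * oneSub ε = 0 := by linear_combination oneSub e ^ a * hx
      simp only [this]
      exact Ideal.zero_mem _
    · exact Ideal.subset_span (Or.inr (by simp only [pow_succ, mul_assoc]; rfl))

theorem generatorIdeal_pow_eq_bot (hε : ε ^ 2 = 1) {j : ℕ} (he : e ^ 2 ^ j = 1) :
    generatorIdeal e ε ^ (2 ^ j + 1) = ⊥ := by
  rw [eq_bot_iff]
  refine (generatorIdeal_pow_succ_le hε _).trans ?_
  have : oneSub e ^ 2 ^ j = 0 := by rw [oneSub_pow_two_pow, he, oneSub_one]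
  rw [Ideal.span_le, pow_succ, this]
  simp

/-- Modulo `J` the order of e divides gcd(m, 2^j), a power of 2 that divides 2^s; Frobenius turns 1
- e^(2^s) into (1 - e)^(2^s). -/
theorem oneSub_pow_mem {J : Ideal (BinaryGroupAlgebra Q)} {j s m : ℕ} (he : e ^ 2 ^ j = 1)
    (hm : ¬ 2 ^ (s + 1) ∣ m) (h : oneSub (e ^ m) ∈ J) : oneSub e ^ 2 ^ s ∈ J := by
  rw [oneSub_pow_two_pow, ← mem_congruenceSubgroup]
  obtain ⟨v, -, hv⟩ := (Nat.dvd_prime_pow Nat.prime_two).1 (Nat.gcd_dvd_right m (2 ^ j))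
  have hvs : v ≤ s := by
    by_contra hlt
    exact hm ((pow_dvd_pow 2 (by omega)).trans (hv ▸ Nat.gcd_dvd_left m (2 ^ j)))
  have h1 : e ^ 2 ^ v ∈ congruenceSubgroup J := by
    have h2 : e ^ ((m : ℤ) * Nat.gcdA m (2 ^ j) + ((2 ^ j : ℕ) : ℤ) * Nat.gcdB m (2 ^ j)) ∈
        congruenceSubgroup J := by
      rw [zpow_add, zpow_mul, zpow_mul, zpow_natCast, zpow_natCast, he, one_zpow, mul_one]
      exact zpow_mem (mem_congruenceSubgroup.2 h) _
    rwa [← Nat.gcd_eq_gcd_ab, hv, zpow_natCast] at h2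
  have : e ^ 2 ^ s = (e ^ 2 ^ v) ^ 2 ^ (s - v) := by
    rw [← pow_mul, ← pow_add, Nat.add_sub_cancel' hvs]
  rw [this]
  exact pow_mem h1 _

/-- Both generators of the ideal power are multiples of 1 - g for g = ε^c e^m. Squaring g removes ε
and handles the pure power of 1 - e. Multiplication by 1 - ε makes ε act as 1, which handles the
mixed generator with half the exponent. -/
theorem generatorIdeal_pow_le_span (hε : ε ^ 2 = 1) {a j s m c : ℕ} (he : e ^ 2 ^ j = 1)
    (hm : ¬ 2 ^ (s + 1) ∣ m) (h1 : 2 ^ s ≤ a) (h2 : 2 ^ (s + 1) ≤ a + 1) :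
    generatorIdeal e ε ^ (a + 1) ≤ Ideal.span {oneSub (ε ^ c * e ^ m)} := by
  refine (generatorIdeal_pow_succ_le hε a).trans ?_
  set J := Ideal.span {oneSub (ε ^ c * e ^ m)} with hJ
  have hg : ε ^ c * e ^ m ∈ congruenceSubgroup J := Ideal.subset_span rfl
  have hy : oneSub e ^ 2 ^ (s + 1) ∈ J := by
    apply oneSub_pow_mem he (m := 2 * m)
    · rw [pow_succ', Nat.mul_dvd_mul_iff_left two_pos]
      exact hm
    · have := pow_mem hg 2
      rwa [mul_pow, ← pow_mul, mul_comm c, pow_mul, hε, one_pow, one_mul, ← pow_mul, mul_comm m]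
        at this
  have hxy : oneSub ε * oneSub e ^ 2 ^ s ∈ J := by
    -- The colon ideal (J : 1 - ε), modulo which ε is 1.
    let J' : Ideal (BinaryGroupAlgebra Q) :=
      Submodule.comap (LinearMap.mulLeft (BinaryGroupAlgebra Q) (oneSub ε)) J
    have hε' : ε ∈ congruenceSubgroup J' := by
      change oneSub ε * oneSub ε ∈ J
      rw [oneSub_mul_self hε]
      exact J.zero_mem
    have hg' : ε ^ c * e ^ m ∈ congruenceSubgroup J' := J.mul_mem_left _ hg
    exact oneSub_pow_mem (J := J') he hm ((Subgroup.mul_mem_cancel_left _ (pow_mem hε' c)).1 hg')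
  rw [Ideal.span_le]
  rintro _ (rfl | rfl)
  · exact J.mem_of_dvd (pow_dvd_pow _ h2) hy
  · exact J.mem_of_dvd (mul_dvd_mul_left _ (pow_dvd_pow _ h1)) hxy

/-- The span of `X` together with the power `I ^ (a + 1)` is the whole group algebra. -/
def SpansModPow (I : Ideal (BinaryGroupAlgebra Q)) (X : Finset Q) (a : ℕ) : Prop :=
  ∀ z : BinaryGroupAlgebra Q,
    ∃ w ∈ Submodule.span (ZMod 2) (MonoidAlgebra.of (ZMod 2) Q '' X), z - w ∈ I ^ (a + 1)

theorem span_of_mono {X Y : Finset Q} (h : X ⊆ Y) :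
    Submodule.span (ZMod 2) (MonoidAlgebra.of (ZMod 2) Q '' X) ≤
      Submodule.span (ZMod 2) (MonoidAlgebra.of (ZMod 2) Q '' Y) :=
  Submodule.span_mono (Set.image_mono (by exact_mod_cast h))

theorem oneSub_mul_mem_span [DecidableEq Q] {X : Finset Q} {w : BinaryGroupAlgebra Q} (g : Q)
    (hw : w ∈ Submodule.span (ZMod 2) (MonoidAlgebra.of (ZMod 2) Q '' X)) :
    oneSub g * w ∈ Submodule.span (ZMod 2)
      (MonoidAlgebra.of (ZMod 2) Q '' (({1, g} * X : Finset Q) : Set Q)) := by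
  induction hw using Submodule.span_induction with
  | mem w hw =>
    obtain ⟨x, hx, rfl⟩ := hw
    rw [oneSub, sub_mul, one_mul, ← map_mul]
    refine sub_mem (Submodule.subset_span ⟨x, ?_, rfl⟩) (Submodule.subset_span ⟨g * x, ?_, rfl⟩)
    · rw [pair_mul]
      exact Finset.mem_coe.2 (Finset.mem_union_left _ hx)
    · exact Finset.mem_coe.2 (Finset.mul_mem_mul (by simp) hx)
  | zero => rw [mul_zero]; exact zero_mem _
  | add u v _ _ hu hv => rw [mul_add]; exact add_mem hu hv
  | smul r u _ hu => rw [mul_smul_comm]; exact Submodule.smul_mem _ _ hu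

/-- Write z = w + s(1 - g) with w in the span of `X`, then approximate s by v in the same span. The
error of s gains a factor 1 - g, and w + (1 - g)v lies in the span of X ∪ gX. -/
theorem SpansModPow.mul_pair [DecidableEq Q] {I : Ideal (BinaryGroupAlgebra Q)} {X : Finset Q} {a : ℕ}
    (h : SpansModPow I X a) {g : Q} (hgI : oneSub g ∈ I)
    (hg : I ^ (a + 1) ≤ Ideal.span {oneSub g}) : SpansModPow I ({1, g} * X) (a + 1) := by
  intro z
  obtain ⟨w, hw, h1⟩ := h z
  obtain ⟨s, hs⟩ := Ideal.mem_span_singleton'.1 (hg h1)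
  obtain ⟨v, hv, h2⟩ := h s
  refine ⟨w + oneSub g * v, add_mem (span_of_mono (by
    rw [pair_mul]; exact Finset.subset_union_left) hw) (oneSub_mul_mem_span g hv), ?_⟩
  have : z - (w + oneSub g * v) = (s - v) * oneSub g := by linear_combination -hs
  rw [this, pow_succ]
  exact Ideal.mul_mem_mul h2 hgI

theorem SpansModPow.mul_subsetProds [DecidableEq Q] {I : Ideal (BinaryGroupAlgebra Q)}
    (hI : ∀ g, oneSub g ∈ I)
    {a : ℕ} (S : Multiset Q) : ∀ {X : Finset Q} {b : ℕ}, a ≤ b → SpansModPow I X b →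
      (∀ g ∈ S, I ^ (a + 1) ≤ Ideal.span {oneSub g}) →
      SpansModPow I (X * subsetProds S) (b + S.card) := by
  induction S using Multiset.induction with
  | empty => intro X b _ h _; simpa [subsetProds_zero] using h
  | cons g S ih =>
    intro X b hab h hS
    have h1 := h.mul_pair (hI g)
      ((Ideal.pow_le_pow_right (by omega)).trans (hS g (Multiset.mem_cons_self _ _)))
    have h2 := ih (by omega) h1 fun g hg => hS g (Multiset.mem_cons_of_mem hg)
    rw [subsetProds_cons, mul_left_comm, ← mul_assoc, Multiset.card_cons]
    convert h2 using 1
    ring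

/-- Distinct group elements are linearly independent, so a subset spanning the whole algebra is the
whole group. -/
theorem SpansModPow.mem_of_pow_eq_bot {I : Ideal (BinaryGroupAlgebra Q)} {X : Finset Q} {a : ℕ}
    (h : SpansModPow I X a) (ha : I ^ (a + 1) = ⊥) (g : Q) : g ∈ X := by
  obtain ⟨w, hw, h1⟩ := h (MonoidAlgebra.of (ZMod 2) Q g)
  rw [ha, Ideal.mem_bot, sub_eq_zero] at h1
  classical
  by_contra hg
  have key : ∀ w ∈ Submodule.span (ZMod 2) (MonoidAlgebra.of (ZMod 2) Q '' X), w.coeff g = 0 := by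
    intro w hw
    induction hw using Submodule.span_induction with
    | mem w hw =>
      obtain ⟨x, hx, rfl⟩ := hw
      rw [coeff_of, if_neg]
      rintro rfl
      exact hg hx
    | zero => simp
    | add u v _ _ hu hv => rw [MonoidAlgebra.coeff_add, Finsupp.add_apply, hu, hv, add_zero]
    | smul r u _ hu => rw [MonoidAlgebra.coeff_smul, Finsupp.smul_apply, hu, smul_zero]
  have := key w hw
  rw [← h1, coeff_of, if_pos rfl] at this
  exact one_ne_zero this

theorem spansModPow_one (hgen : ∀ q : Q, ∃ c m : ℕ, q = ε ^ c * e ^ m) :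
    SpansModPow (generatorIdeal e ε) 1 0 := by
  intro z
  rw [zero_add, pow_one]
  induction z using MonoidAlgebra.induction_on with
  | of g =>
    refine ⟨1, Submodule.subset_span ⟨1, by simp, map_one _⟩, ?_⟩
    rw [← neg_sub]
    exact neg_mem (oneSub_mem_generatorIdeal hgen g)
  | add u v hu hv =>
    obtain ⟨w, hw, h⟩ := hu
    obtain ⟨w', hw', h'⟩ := hv
    exact ⟨w + w', add_mem hw hw', by rw [add_sub_add_comm]; exact add_mem h h'⟩
  | smul r u hu =>
    obtain ⟨w, hw, h⟩ := hu
    exact ⟨r • w, Submodule.smul_mem _ _ hw, by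
      rw [← smul_sub, Algebra.smul_def]; exact Ideal.mul_mem_left _ _ h⟩

end TwoGenerators

/-! ### The size of multisets with aperiodic subset products -/

section AperiodicBound

theorem oneSub_pow_sub_nsmul_mem {Q : Type*} [CommGroup Q] {I : Ideal (BinaryGroupAlgebra Q)}
    {e : Q} (he : oneSub e ∈ I) (m : ℕ) : oneSub (e ^ m) - m • oneSub e ∈ I ^ 2 := by
  induction m with
  | zero => simp [oneSub_one]
  | succ m ih =>
    have h : oneSub (e ^ m) ∈ I := pow_mem (mem_congruenceSubgroup.2 he) m
    have : oneSub (e ^ (m + 1)) - (m + 1) • oneSub e =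
        (oneSub (e ^ m) - m • oneSub e) - oneSub (e ^ m) * oneSub e := by
      rw [pow_succ, oneSub_mul, succ_nsmul]
      ring
    rw [this, sq]
    rw [sq] at ih
    exact sub_mem ih (Ideal.mul_mem_mul h he)

/-- Modulo I², 1 - εe^m is (1 - ε) + m(1 - e), so the three given elements yield the constants and
both generators of I/I². -/
theorem spansModPow_of_mem {Q : Type*} [CommGroup Q] {e ε : Q}
    (hgen : ∀ q : Q, ∃ c m : ℕ, q = ε ^ c * e ^ m) {X : Finset Q} {m : ℕ} (h1 : 1 ∈ X) (he : e ∈ X)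
    (hεm : ε * e ^ m ∈ X) : SpansModPow (generatorIdeal e ε) X 1 := by
  set I := generatorIdeal e ε with hI
  have hIg := oneSub_mem_generatorIdeal hgen
  have hspan : ∀ g ∈ X, MonoidAlgebra.of (ZMod 2) Q g ∈
      Submodule.span (ZMod 2) (MonoidAlgebra.of (ZMod 2) Q '' X) := fun g hg =>
    Submodule.subset_span ⟨g, hg, rfl⟩
  have hspan1 := hspan 1 h1
  rw [map_one] at hspan1
  have hconst : ∀ z : BinaryGroupAlgebra Q, ∃ r : ZMod 2, z - r • 1 ∈ I := by
    intro z
    obtain ⟨w, hw, h⟩ := spansModPow_one hgen z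
    rw [Finset.coe_one, Set.image_one, map_one, Submodule.mem_span_singleton] at hw
    obtain ⟨r, rfl⟩ := hw
    rw [zero_add, pow_one] at h
    exact ⟨r, h⟩
  intro z
  obtain ⟨r, hr⟩ := hconst z
  obtain ⟨a, b, hab⟩ := Ideal.mem_span_pair.1 hr
  obtain ⟨s, hs⟩ := hconst a
  obtain ⟨t, ht⟩ := hconst b
  refine ⟨r • 1 + s • (oneSub (ε * e ^ m) - m • oneSub e) + t • oneSub e, ?_, ?_⟩
  · refine add_mem (add_mem (Submodule.smul_mem _ _ hspan1) (Submodule.smul_mem _ _ ?_))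
      (Submodule.smul_mem _ _ (sub_mem hspan1 (hspan e he)))
    exact sub_mem (sub_mem hspan1 (hspan _ hεm)) (nsmul_mem (sub_mem hspan1 (hspan e he)) _)
  · have h2 : z - (r • 1 + s • (oneSub (ε * e ^ m) - m • oneSub e) + t • oneSub e) =
        (a - s • 1) * oneSub ε + (b - t • 1) * oneSub e +
        (s • 1) * (oneSub ε * oneSub (e ^ m)) - (s • 1) * (oneSub (e ^ m) - m • oneSub e) := by
      rw [oneSub_mul]
      simp only [smul_one_mul, sub_mul, smul_sub, smul_add]
      rw [← sub_eq_zero] at hab ⊢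
      linear_combination -hab
    have h3 := oneSub_pow_sub_nsmul_mem (hIg e) m
    rw [h2, show (1 + 1 : ℕ) = 2 from rfl]
    rw [sq] at h3 ⊢
    exact sub_mem (add_mem (add_mem (Ideal.mul_mem_mul hs (hIg ε)) (Ideal.mul_mem_mul ht (hIg e)))
      (Ideal.mul_mem_left _ _ (Ideal.mul_mem_mul (hIg ε) (hIg _)))) (Ideal.mul_mem_left _ _ h3)

/-- If g² = 1, then g fixes {1, g}, a factor of the set of subset products. -/
theorem sq_ne_one_of_aperiodic {Q : Type*} [CommGroup Q] [DecidableEq Q] {S : Multiset Q}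
    (h1 : ∀ g ∈ S, g ≠ 1) (h : Aperiodic (subsetProds S)) {g : Q} (hg : g ∈ S) : g ^ 2 ≠ 1 := by
  intro h2
  refine h1 g hg (h g ?_)
  obtain ⟨T, rfl⟩ := Multiset.exists_cons_of_mem hg
  rw [subsetProds_cons, ← smul_mul_assoc]
  congr 1
  rw [sq] at h2
  rw [Finset.smul_finset_insert, Finset.smul_finset_singleton, smul_eq_mul, smul_eq_mul, mul_one,
    h2, Finset.pair_comm]

/-- In a group generated by an involution and an element of order dividing `2 ^ j`, nontrivial
elements whose subset products form an aperiodic set number at most `2 ^ j`. -/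
theorem card_le_two_pow_of_aperiodic (j : ℕ) : ∀ {Q : Type*} [CommGroup Q] [DecidableEq Q]
    {e ε : Q}, ε ^ 2 = 1 → e ^ 2 ^ j = 1 → (∀ q : Q, ∃ c m : ℕ, q = ε ^ c * e ^ m) →
    ∀ S : Multiset Q, (∀ g ∈ S, g ≠ 1) → Aperiodic (subsetProds S) → S.card ≤ 2 ^ j := by
  induction j with
  | zero =>
    intro Q _ _ e ε hε he hgen S h1 h
    rcases S.empty_or_exists_mem with rfl | ⟨g, hg⟩
    · simp
    · obtain ⟨c, m, rfl⟩ := hgen g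
      refine absurd ?_ (sq_ne_one_of_aperiodic h1 h hg)
      rw [pow_zero, pow_one] at he
      rw [he, one_pow, mul_one, ← pow_mul, mul_comm, pow_mul, hε, one_pow]
  | succ j ih =>
    intro Q _ _ e ε hε he hgen S h1 h
    classical
    by_contra! hS
    have hcε : ∀ c : ℕ, (ε ^ c) ^ 2 = 1 := fun c => by
      rw [← pow_mul, mul_comm, pow_mul, hε, one_pow]
    -- the subgroup `⟨ε, e²⟩` contains few elements of `S`
    let L : Subgroup Q :=
      { carrier := {q | ∃ c m : ℕ, q = ε ^ c * (e ^ 2) ^ m}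
        mul_mem' := by
          rintro _ _ ⟨c, m, rfl⟩ ⟨c', m', rfl⟩
          exact ⟨c + c', m + m', by rw [pow_add, pow_add, mul_mul_mul_comm]⟩
        one_mem' := ⟨0, 0, by simp⟩
        inv_mem' := by
          rintro _ ⟨c, m, rfl⟩
          refine ⟨c, m * (2 ^ j - 1), ?_⟩
          rw [inv_eq_iff_mul_eq_one, mul_mul_mul_comm, ← sq, hcε, one_mul, ← pow_add]
          have : m + m * (2 ^ j - 1) = 2 ^ j * m := by
            obtain ⟨t, ht⟩ := Nat.exists_eq_add_of_le' (Nat.one_le_two_pow (n := j))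
            rw [ht, Nat.add_sub_cancel]; ring
          rw [this, pow_mul, ← pow_mul e, ← pow_succ', he, one_pow] }
    have hL : ∀ c m : ℕ, 2 ∣ m → ε ^ c * e ^ m ∈ L := by
      rintro c _ ⟨m, rfl⟩
      exact ⟨c, m, by rw [← pow_mul]⟩
    have hSL : (S.filter (· ∈ L)).card ≤ 2 ^ j := by
      obtain ⟨U, hU⟩ : ∃ U : Multiset L, U.map L.subtype = S.filter (· ∈ L) := by
        have : ∀ g ∈ S.filter (· ∈ L), g ∈ L := fun g hg => (Multiset.mem_filter.1 hg).2
        refine ⟨(S.filter (· ∈ L)).pmap (fun g hg => ⟨g, hg⟩) this, ?_⟩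
        rw [Multiset.map_pmap]
        exact (Multiset.pmap_eq_map _ id _ _).trans (Multiset.map_id _)
      have hUS : ∀ g ∈ U, (g : Q) ∈ S := fun g hg =>
        (Multiset.mem_filter.1 (hU ▸ Multiset.mem_map_of_mem L.subtype hg)).1
      rw [← hU, Multiset.card_map]
      refine ih (e := ⟨e ^ 2, 0, 1, by simp⟩) (ε := ⟨ε, 1, 0, by simp⟩) (Subtype.ext hε)
        (Subtype.ext ?_) ?_ U ?_ ?_
      · rw [Subgroup.coe_pow, ← pow_mul, ← pow_succ', he, Subgroup.coe_one]
      · rintro ⟨_, c, m, rfl⟩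
        exact ⟨c, m, Subtype.ext (by simp)⟩
      · rintro g hg rfl
        exact h1 _ (hUS _ hg) rfl
      · intro g hg
        have h3 := h.subsetProds_of_le (Multiset.filter_le (· ∈ L) S)
        rw [← hU, subsetProds_map] at h3
        refine Subtype.ext (h3 g ?_)
        conv_rhs => rw [← hg]
        ext x
        simp only [Finset.mem_smul_finset, Finset.mem_image]
        constructor
        · rintro ⟨_, ⟨y, hy, rfl⟩, rfl⟩
          exact ⟨_, ⟨y, hy, rfl⟩, rfl⟩
        · rintro ⟨_, ⟨y, hy, rfl⟩, rfl⟩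
          exact ⟨_, ⟨y, hy, rfl⟩, rfl⟩
    have hcard : (S.filter (· ∈ L)).card + (S.filter (· ∉ L)).card = S.card := by
      rw [← Multiset.card_add, Multiset.filter_add_not]
    rw [pow_succ] at hS
    -- replace `e` by an element `f ∉ L` of `S`
    obtain ⟨f, hf⟩ := Multiset.card_pos_iff_exists_mem.1
      (show 0 < (S.filter (· ∉ L)).card by omega)
    obtain ⟨hfS, hfL⟩ := Multiset.mem_filter.1 hf
    obtain ⟨a, m₀, hfe⟩ := hgen f
    have hm₀ : ¬ 2 ∣ m₀ := fun hm => hfL (hfe ▸ hL a m₀ hm)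
    have hf2 : f ^ 2 = (e ^ 2) ^ m₀ := by
      rw [hfe, mul_pow, hcε, one_mul, ← pow_mul, mul_comm, pow_mul]
    have hfpow : f ^ 2 ^ (j + 1) = 1 := by
      rw [pow_succ', pow_mul, hf2, ← pow_mul, ← pow_mul, mul_comm m₀, ← mul_assoc, ← pow_succ',
        pow_mul, he, one_pow]
    have hfgen : ∀ q : Q, ∃ c m : ℕ, q = ε ^ c * f ^ m := by
      obtain ⟨r, hr⟩ : ∃ r : ℕ, e = e ^ (m₀ * r) := by
        have hco : Nat.Coprime m₀ (2 ^ (j + 1)) :=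
          ((Nat.prime_two.coprime_iff_not_dvd.2 hm₀).symm).pow_right _
        obtain ⟨r, -, hr⟩ := Nat.exists_mul_mod_eq_one_of_coprime hco (Nat.one_lt_two_pow (by simp))
        refine ⟨r, ?_⟩
        rw [← Nat.div_add_mod (m₀ * r) (2 ^ (j + 1)), hr, pow_add, pow_mul, he, one_pow, one_mul,
          pow_one]
      have hr2 : e = ε ^ (a * r) * f ^ r := by
        rw [hfe, mul_pow, ← pow_mul, ← pow_mul, ← mul_assoc, ← pow_add, ← two_mul, pow_mul, hε,
          one_pow, one_mul, ← hr]
      intro q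
      obtain ⟨c, m, rfl⟩ := hgen q
      refine ⟨c + a * r * m, r * m, ?_⟩
      conv_lhs => rw [hr2]
      rw [mul_pow, ← pow_mul, ← pow_mul, ← mul_assoc, pow_add]
    obtain ⟨g, hgS, hgf⟩ : ∃ g ∈ S, ∀ m : ℕ, g ≠ f ^ m := by
      by_contra! hall
      -- Otherwise all subset products lie among at most 2^(j+1) powers of `f`, too few for an
      -- aperiodic set coming from more than 2^(j+1) nontrivial elements.
      have hsub : subsetProds S ⊆ (Finset.range (2 ^ (j + 1))).image (f ^ ·) := by
        intro x hx
        have hx := subsetProds_subset_subgroup (M := Subgroup.zpowers f) (fun y hy => by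
          obtain ⟨m, rfl⟩ := hall y hy
          exact pow_mem (Subgroup.mem_zpowers f) m) hx
        have hfin : IsOfFinOrder f := isOfFinOrder_iff_pow_eq_one.2 ⟨_, by positivity, hfpow⟩
        obtain ⟨m, rfl⟩ := (hfin.mem_powers_iff_mem_zpowers).2 hx
        refine Finset.mem_image.2 ⟨m % 2 ^ (j + 1), Finset.mem_range.2 (Nat.mod_lt _ (by positivity)),
          ?_⟩
        change f ^ _ = f ^ m
        conv_rhs => rw [← Nat.div_add_mod m (2 ^ (j + 1)), pow_add, pow_mul, hfpow, one_pow, one_mul]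
      have h2 := (Finset.card_le_card hsub).trans Finset.card_image_le
      have h3 := card_lt_card_subsetProds_of_aperiodic h1 h
      rw [Finset.card_range, pow_succ] at h2
      omega
    -- the remaining elements
    obtain ⟨S', rfl⟩ := Multiset.exists_cons_of_mem hfS
    obtain ⟨S'', rfl⟩ := Multiset.exists_cons_of_mem
      ((Multiset.mem_cons.1 hgS).resolve_left fun h => hgf 1 (by rw [h, pow_one]))
    have hI := oneSub_mem_generatorIdeal hfgen
    have hbase : SpansModPow (generatorIdeal f ε) ({1, f} * {1, g}) 1 := by
      obtain ⟨c, m, hg⟩ := hfgen g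
      have hg' : g = ε * f ^ m := by
        rcases Nat.even_or_odd' c with ⟨c, rfl | rfl⟩
        · exact absurd (by rw [hg, pow_mul, hε, one_pow, one_mul]) (hgf m)
        · rw [hg, pow_succ, pow_mul, hε, one_pow, one_mul]
      refine spansModPow_of_mem hfgen (m := m) ?_ ?_ ?_
      · exact Finset.mem_mul.2 ⟨1, by simp, 1, by simp, by simp⟩
      · exact Finset.mem_mul.2 ⟨f, by simp, 1, by simp, by simp⟩
      · exact Finset.mem_mul.2 ⟨1, by simp, g, by simp, by rw [one_mul, hg']⟩
    -- Elements outside `L` have odd exponent of `f` and can be absorbed from depth 1 on. They go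
    -- first, to reach the depth 2^j at which elements of `L` can be absorbed.
    have hodd := hbase.mul_subsetProds hI (S''.filter (· ∉ L)) le_rfl (by
      intro x hx
      obtain ⟨c, m, rfl⟩ := hfgen x
      refine generatorIdeal_pow_le_span hε (s := 0) hfpow ?_ le_rfl le_rfl
      rintro ⟨m, rfl⟩
      refine (Multiset.mem_filter.1 hx).2 ⟨c, m₀ * m, ?_⟩
      rw [zero_add, pow_one, pow_mul, hf2, ← pow_mul])
    have hcard' : (S''.filter (· ∈ L)).card + (S''.filter (· ∉ L)).card = S''.card := by
      rw [← Multiset.card_add, Multiset.filter_add_not]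
    have hodd_card : 2 ^ j ≤ 1 + (S''.filter (· ∉ L)).card := by
      have h2 := (Multiset.card_le_card (Multiset.filter_le_filter (· ∈ L)
        ((Multiset.le_cons_self S'' g).trans (Multiset.le_cons_self _ f)))).trans hSL
      simp only [Multiset.card_cons] at hS
      omega
    have hall := hodd.mul_subsetProds hI (S''.filter (· ∈ L)) le_rfl (by
      intro x hx
      have hxS : x ∈ f ::ₘ g ::ₘ S'' := Multiset.mem_cons_of_mem (Multiset.mem_cons_of_mem
        (Multiset.mem_of_le (Multiset.filter_le _ _) hx))
      have hx2 := sq_ne_one_of_aperiodic h1 h hxS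
      obtain ⟨c, m, rfl⟩ := hfgen x
      have hm : ¬ 2 ^ j ∣ m := by
        rintro ⟨m, rfl⟩
        apply hx2
        rw [mul_pow, hcε, one_mul, ← pow_mul, mul_right_comm, ← pow_succ, pow_mul, hfpow, one_pow]
      rcases j with _ | j
      · exact absurd (one_dvd m) hm
      · refine generatorIdeal_pow_le_span hε hfpow hm ?_ (hodd_card.trans (Nat.le_succ _))
        rw [pow_succ] at hodd_card
        omega)
    have hX : {1, f} * {1, g} * subsetProds (S''.filter (· ∉ L)) *
        subsetProds (S''.filter (· ∈ L)) = subsetProds (f ::ₘ g ::ₘ S'') := by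
      conv_rhs => rw [subsetProds_cons, subsetProds_cons, ← Multiset.filter_add_not (· ∈ L) S'',
        subsetProds_add]
      rw [mul_comm (subsetProds (S''.filter (· ∈ L))), mul_assoc, mul_assoc]
    rw [hX] at hall
    -- The exponent reached is the size of the original multiset, at least 2^(j+1) + 1, where the
    -- ideal power vanishes.
    have huniv := hall.mem_of_pow_eq_bot (by
      rw [eq_bot_iff, ← generatorIdeal_pow_eq_bot hε hfpow]
      apply Ideal.pow_le_pow_right
      simp only [Multiset.card_cons] at hS
      rw [pow_succ]
      omega)
    exact h1 f hfS (h f (smul_eq_self_of_subset fun x _ => huniv x))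

end AperiodicBound

/-! ### The length of strict chains -/

section ChainBound

theorem natCard_le_two_pow_succ {Q : Type*} [CommGroup Q] {j : ℕ} {e ε : Q} (hε : ε ^ 2 = 1)
    (he : e ^ 2 ^ j = 1) (hgen : ∀ q : Q, ∃ c m : ℕ, q = ε ^ c * e ^ m) : Nat.card Q ≤ 2 ^ (j + 1) := by
  have hsurj : Function.Surjective
      (fun x : Fin 2 × Fin (2 ^ j) => ε ^ (x.1 : ℕ) * e ^ (x.2 : ℕ)) := by
    intro q
    obtain ⟨c, m, rfl⟩ := hgen q
    refine ⟨(⟨c % 2, Nat.mod_lt _ two_pos⟩, ⟨m % 2 ^ j, Nat.mod_lt _ (by positivity)⟩), ?_⟩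
    change ε ^ (c % 2) * e ^ (m % 2 ^ j) = _
    congr 1
    · conv_rhs => rw [← Nat.div_add_mod c 2, pow_add, pow_mul, hε, one_pow, one_mul]
    · conv_rhs => rw [← Nat.div_add_mod m (2 ^ j), pow_add, pow_mul, he, one_pow, one_mul]
  have := Nat.card_le_card_of_surjective _ hsurj
  simpa [pow_succ'] using this

variable {Q : Type*} [CommGroup Q] [DecidableEq Q]

theorem card_filter_add_card_aperiodicPart (S : Multiset Q)
    [DecidablePred (· ∈ MulAction.stabilizer Q (subsetProds S))] :
    (S.filter (· ∈ MulAction.stabilizer Q (subsetProds S))).card + (aperiodicPart S).card =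
      S.card := by
  rw [aperiodicPart, Multiset.card_map]
  conv_rhs => rw [← Multiset.filter_add_not (· ∈ MulAction.stabilizer Q (subsetProds S)) S,
    Multiset.card_add]
  congr!

/-- Drop the last element, which moves the set of products of the others. If that set is aperiodic,
`card_le_two_pow_of_aperiodic` applies; if not, count separately inside its nontrivial stabilizer M
and in the quotient by M. -/
theorem StrictChain.length_le_two_pow_add_one [Finite Q] {j : ℕ} {e ε : Q} (hε : ε ^ 2 = 1)
    (he : e ^ 2 ^ j = 1) (hgen : ∀ q : Q, ∃ c m : ℕ, q = ε ^ c * e ^ m) {R : List Q}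
    (h : StrictChain 1 R) : R.length ≤ 2 ^ j + 1 := by
  classical
  rcases R.eq_nil_or_concat with rfl | ⟨R, c, rfl⟩
  · simp
  rw [List.concat_eq_append, strictChain_append] at h
  rw [List.concat_eq_append, List.length_append, List.length_singleton, Nat.add_le_add_iff_right]
  obtain ⟨h, hc, -⟩ := h
  rw [one_mul] at hc
  by_cases hap : Aperiodic (subsetProds (R : Multiset Q))
  · exact card_le_two_pow_of_aperiodic j hε he hgen (R : Multiset Q) (by simpa using h.ne_one) hap
  · set M := MulAction.stabilizer Q (subsetProds (R : Multiset Q)) with hM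
    have hM1 : 1 < Nat.card M := by
      simp only [Aperiodic, not_forall] at hap
      obtain ⟨g, hg, hg1⟩ := hap
      have : Nontrivial M := ⟨⟨⟨g, hg⟩, 1, fun h => hg1 (congrArg Subtype.val h)⟩⟩
      exact Finite.one_lt_card
    have hsub : (R.filter (· ∈ M)).length + 1 ≤ Nat.card M := by
      have h1 : StrictChain 1 (R.filter (· ∈ M)) :=
        StrictChain.sublist List.filter_sublist (Y := 1) (by rwa [mul_one])
      have h2 := h1.card_add_le
      rw [one_mul, Finset.card_one] at h2
      refine h2.trans ?_
      rw [← Set.ncard_coe_finset]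
      refine (Set.ncard_le_ncard (t := (M : Set Q)) fun x hx => ?_).trans_eq
        (Nat.card_coe_set_eq (M : Set Q)).symm
      exact subsetProds_subset_subgroup (fun g hg => by simpa using (List.mem_filter.1
        (Multiset.mem_coe.1 hg)).2) hx
    have hquot : (aperiodicPart (R : Multiset Q)).card + 2 ≤ Nat.card (Q ⧸ M) := by
      have h1 := card_lt_card_subsetProds_of_aperiodic
        (ne_one_of_mem_aperiodicPart (R : Multiset Q)) (aperiodic_aperiodicPart _)
      -- The last element `c` moves this set, so it is not the whole group; this saves one more in
      -- the quotient.
      obtain ⟨g, hg⟩ : ∃ g, g ∉ subsetProds (R : Multiset Q) := by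
        by_contra! hall
        exact hc (smul_eq_self_of_subset fun x _ => hall x)
      rw [← mk_mem_subsetProds_aperiodicPart] at hg
      have : Fintype (Q ⧸ M) := Fintype.ofFinite _
      have h2 : (subsetProds (aperiodicPart (R : Multiset Q))).card < Nat.card (Q ⧸ M) := by
        rw [Nat.card_eq_fintype_card]
        exact Finset.card_lt_univ_of_notMem hg
      omega
    have hlen : (R.filter (· ∈ M)).length + (aperiodicPart (R : Multiset Q)).card = R.length :=
      card_filter_add_card_aperiodicPart (R : Multiset Q)
    have hcard := Subgroup.card_eq_card_quotient_mul_card_subgroup M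
    have hle := natCard_le_two_pow_succ hε he hgen
    obtain ⟨a, ha⟩ := Nat.exists_eq_add_of_le' (show 2 ≤ Nat.card M from hM1)
    obtain ⟨b, hb⟩ := Nat.exists_eq_add_of_le' (show 2 ≤ Nat.card (Q ⧸ M) by omega)
    -- This is (a + 2)(b + 2) ≥ 2(a + b + 2).
    have : 2 * (a + b + 2) ≤ 2 * 2 ^ j := by
      rw [← pow_succ']
      refine le_trans ?_ hle
      rw [hcard, ha, hb]
      nlinarith [Nat.zero_le (a * b)]
    omega

end ChainBound

/-! ### Product-one free multisets and long products -/

section ProductOneFree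

/-- A multiset without nonempty sub-multisets of product `1`. -/
def ProductOneFree {G : Type*} [CommGroup G] (A : Multiset G) : Prop :=
  ∀ T ≤ A, T.prod = 1 → T = 0

theorem Multiset.exists_add_of_le_add {α : Type*} {S T U : Multiset α} (h : U ≤ S + T) :
    ∃ V ≤ S, ∃ W ≤ T, U = V + W := by
  classical
  exact ⟨U ∩ S, Multiset.inter_le_right, U - S, Multiset.sub_le_iff_le_add'.2 h,
    by rw [add_comm, Multiset.sub_add_inter]⟩

theorem Multiset.exists_map_eq_of_le_map {α β : Type*} {f : α → β} {S : Multiset α} :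
    ∀ {T : Multiset β}, T ≤ S.map f → ∃ U ≤ S, U.map f = T := by
  induction S using Multiset.induction with
  | empty => intro T h; exact ⟨0, le_rfl, (Multiset.le_zero.1 h).symm⟩
  | cons a S ih =>
    intro T h
    rw [Multiset.map_cons] at h
    by_cases ha : f a ∈ T
    · obtain ⟨T, rfl⟩ := Multiset.exists_cons_of_mem ha
      obtain ⟨U, hU, rfl⟩ := ih ((Multiset.cons_le_cons_iff _).1 h)
      exact ⟨a ::ₘ U, Multiset.cons_le_cons a hU, Multiset.map_cons _ _ _⟩
    · obtain ⟨U, hU, rfl⟩ := ih ((Multiset.le_cons_of_notMem ha).1 h)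
      exact ⟨U, hU.trans (Multiset.le_cons_self _ _), rfl⟩

variable {G Q : Type*} [CommGroup G] [CommGroup Q]

theorem ProductOneFree.mono {A B : Multiset G} (h : ProductOneFree B) (hAB : A ≤ B) :
    ProductOneFree A := fun T hT => h T (hT.trans hAB)

theorem ProductOneFree.card_lt_davenport [Finite G] {A : Multiset G} (h : ProductOneFree A) :
    A.card < davenport G := by
  by_contra! hle
  obtain ⟨T, hT, hTs, hT1⟩ := (davenport_isLeast G).1.2 (A.toList.take (davenport G)) (by simpa)
  refine hT ?_
  have := h T (by
    rw [← Multiset.coe_toList A]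
    exact (hTs.trans (List.take_sublist _ _)).subperm) (by simpa using hT1)
  simpa using this

theorem exists_productOneFree_card [Finite G] :
    ∃ A : List G, A.length + 1 = davenport G ∧ ProductOneFree (A : Multiset G) := by
  have hpos := (davenport_isLeast G).1.1
  rcases Nat.eq_or_lt_of_le (Nat.succ_le_of_lt hpos) with h1 | h1
  · exact ⟨[], h1, fun T hT _ => by simpa using hT⟩
  have h2 : ¬ IsDavenportLength G (davenport G - 1) := fun h2 => by
    have := (davenport_isLeast G).2 ⟨by omega, h2⟩
    omega
  simp only [IsDavenportLength, not_forall] at h2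
  obtain ⟨A, hA, h3⟩ := h2
  refine ⟨A, by omega, fun T hT hT1 => ?_⟩
  induction T using Quotient.inductionOn with
  | h T =>
    obtain ⟨T', hp, hs⟩ := Multiset.coe_le.1 hT
    by_contra hne
    refine h3 ⟨T', ?_, hs, ?_⟩
    · rintro rfl
      exact hne (by simpa using hp.symm)
    · rw [hp.prod_eq]
      simpa using hT1

/-- Applying ρ to a relation kills the part from `A`, so the part from `C` is empty; then freeness
of `A` finishes. -/
theorem ProductOneFree.add_map {ρ : G →* Q} {σ : Q → G} (hσ : ∀ q, ρ (σ q) = q) {A : Multiset G}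
    {C : Multiset Q} (hA : ProductOneFree A) (hA1 : ∀ a ∈ A, ρ a = 1) (hC : ProductOneFree C) :
    ProductOneFree (A + C.map σ) := by
  intro T hT hT1
  obtain ⟨V, hV, W, hW, rfl⟩ := Multiset.exists_add_of_le_add hT
  obtain ⟨U, hU, rfl⟩ := Multiset.exists_map_eq_of_le_map hW
  rw [Multiset.prod_add] at hT1
  have hV1 : ρ V.prod = 1 := by
    rw [map_multiset_prod]
    refine Multiset.prod_eq_one fun x hx => ?_
    obtain ⟨a, ha, rfl⟩ := Multiset.mem_map.1 hx
    exact hA1 a (Multiset.mem_of_le hV ha)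
  have hU1 : U.prod = 1 := by
    have := congrArg ρ hT1
    rw [map_mul, hV1, one_mul, map_multiset_prod, Multiset.map_map, map_one] at this
    simpa [hσ] using this
  rw [hC U hU hU1, Multiset.map_zero, Multiset.prod_zero, mul_one] at hT1
  rw [hC U hU hU1, hA V hV hT1, Multiset.map_zero, add_zero]

theorem card_add_card_lt_davenport [Finite G] {ρ : G →* Q} (hρ : Function.Surjective ρ)
    {A : Multiset G} {C : Multiset Q} (hA : ProductOneFree A) (hA1 : ∀ a ∈ A, ρ a = 1)
    (hC : ProductOneFree C) : A.card + C.card < davenport G := by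
  simpa using (hA.add_map (Function.surjInv_eq hρ) hA1 hC).card_lt_davenport

theorem productOneFree_replicate (g : Q) : ProductOneFree (Multiset.replicate (orderOf g - 1) g) := by
  intro T hT hT1
  obtain ⟨n, hn, rfl⟩ := Multiset.le_replicate_iff.1 hT
  rw [Multiset.prod_replicate] at hT1
  by_contra hne
  have hn0 : n ≠ 0 := by rintro rfl; exact hne rfl
  have := orderOf_le_of_pow_eq_one (Nat.pos_of_ne_zero hn0) hT1
  omega

theorem productOneFree_cons_replicate {e ε : Q} (hε : ε ∉ Subgroup.zpowers e) :
    ProductOneFree (ε ::ₘ Multiset.replicate (orderOf e - 1) e) := by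
  intro T hT hT1
  by_cases h : ε ∈ T
  · obtain ⟨T, rfl⟩ := Multiset.exists_cons_of_mem h
    obtain ⟨n, hn, rfl⟩ := Multiset.le_replicate_iff.1 ((Multiset.cons_le_cons_iff _).1 hT)
    rw [Multiset.prod_cons, Multiset.prod_replicate] at hT1
    exact absurd (eq_inv_of_mul_eq_one_left hT1 ▸
      inv_mem (pow_mem (Subgroup.mem_zpowers e) n)) hε
  · exact productOneFree_replicate e T ((Multiset.le_cons_of_notMem h).1 hT) hT1

theorem card_filter_add_card_map_filter [DecidableEq Q] (ρ : G →* Q) (A : Multiset G) :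
    (A.filter (ρ · = 1)).card + ((A.filter (ρ · ≠ 1)).map ρ).card = A.card := by
  rw [Multiset.card_map, ← Multiset.card_add, Multiset.filter_add_not]

theorem ProductOneFree.card_filter_add_card_lt_davenport [Finite G] [DecidableEq Q] {ρ : G →* Q}
    (hρ : Function.Surjective ρ) {A : Multiset G} (hA : ProductOneFree A) {C : Multiset Q}
    (hC : ProductOneFree C) : (A.filter (ρ · = 1)).card + C.card < davenport G :=
  card_add_card_lt_davenport hρ (hA.mono (Multiset.filter_le _ _))
    (fun _ ha => (Multiset.mem_filter.1 ha).2) hC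

/-- If the image of the elements outside the kernel is not product-one free, it contributes one
further element of the kernel. -/
theorem ProductOneFree.card_filter_add_card_add_one_lt_davenport [Finite G] [DecidableEq Q]
    {ρ : G →* Q} (hρ : Function.Surjective ρ) {A : Multiset G} (hA : ProductOneFree A)
    (hA' : ¬ ProductOneFree ((A.filter (ρ · ≠ 1)).map ρ)) {C : Multiset Q}
    (hC : ProductOneFree C) : (A.filter (ρ · = 1)).card + C.card + 1 < davenport G := by
  simp only [ProductOneFree, not_forall] at hA'
  obtain ⟨T, hT, hT1, hT0⟩ := hA'
  obtain ⟨U, hU, rfl⟩ := Multiset.exists_map_eq_of_le_map hT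
  have hle : ∀ V ≤ A.filter (ρ · = 1), V + U ≤ A := fun V hV => by
    conv_rhs => rw [← Multiset.filter_add_not (ρ · = 1) A]
    exact add_le_add hV hU
  have h := card_add_card_lt_davenport (A := U.prod ::ₘ A.filter (ρ · = 1)) hρ ?_ ?_ hC
  · rw [Multiset.card_cons] at h
    omega
  · intro V hV hV1
    by_cases hUV : U.prod ∈ V
    · obtain ⟨V, rfl⟩ := Multiset.exists_cons_of_mem hUV
      have h1 := hA _ (hle V ((Multiset.cons_le_cons_iff _).1 hV)) (by
        rw [Multiset.prod_add, mul_comm, ← Multiset.prod_cons, hV1])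
      have hU0 : U = 0 := Multiset.le_zero.1 (h1 ▸ Multiset.le_add_left U V)
      rw [hU0, Multiset.map_zero] at hT0
      exact absurd rfl hT0
    · exact hA V (((Multiset.le_cons_of_notMem hUV).1 hV).trans (Multiset.filter_le _ _)) hV1
  · intro a ha
    rcases Multiset.mem_cons.1 ha with rfl | ha
    · rw [map_multiset_prod, hT1]
    · exact (Multiset.mem_filter.1 ha).2

theorem ne_one_of_mem_map_filter [DecidableEq Q] {ρ : G →* Q} {A : Multiset G} :
    ∀ q ∈ (A.filter (ρ · ≠ 1)).map ρ, q ≠ 1 := by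
  intro q hq
  obtain ⟨a, ha, rfl⟩ := Multiset.mem_map.1 hq
  exact (Multiset.mem_filter.1 ha).2

/-- Extending an aperiodic set of products by a strict chain. -/
theorem exists_strictChain_append_and_prod_inv_mem [DecidableEq Q] {S : Multiset Q}
    (h1 : ∀ g ∈ S, g ≠ 1) (hap : Aperiodic (subsetProds S)) (B : Multiset Q) :
    ∃ (R : List Q) (T : Multiset Q), StrictChain 1 (S.toList ++ R) ∧ T ≤ B ∧
      B.card ≤ T.card + R.length ∧ T.prod⁻¹ ∈ subsetProds S := by
  obtain ⟨R, T, hR, h⟩ := exists_strictChain_and_prod_inv_mem B _ (one_mem_subsetProds S)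
  refine ⟨R, T, strictChain_append.2 ⟨strictChain_of_aperiodic (by simpa using h1) ?_, ?_⟩, h⟩
  · rwa [one_mul, Multiset.coe_toList]
  · rwa [one_mul, Multiset.coe_toList]

theorem exists_long_prod_of_isCyclic [Finite G] [DecidableEq Q] [IsCyclic Q] {ρ : G →* Q}
    (hρ : Function.Surjective ρ) {A : Multiset G} (hA : ProductOneFree A)
    (hap : Aperiodic (subsetProds ((A.filter (ρ · ≠ 1)).map ρ))) (B : Multiset Q) {k : ℕ}
    (hk : davenport G + k ≤ A.card + B.card + 1) :
    ∃ T ≤ B, k ≤ T.card ∧ T.prod⁻¹ ∈ subsetProds ((A.filter (ρ · ≠ 1)).map ρ) := by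
  obtain ⟨R, T, hR, hT, hTR, hT1⟩ :=
    exists_strictChain_append_and_prod_inv_mem ne_one_of_mem_map_filter hap B
  refine ⟨T, hT, ?_, hT1⟩
  have hfin : Finite Q := Finite.of_surjective ρ hρ
  have : Fintype Q := Fintype.ofFinite Q
  obtain ⟨g, hg⟩ := IsCyclic.exists_ofOrder_eq_natCard (α := Q)
  have h1 := hA.card_filter_add_card_lt_davenport hρ (productOneFree_replicate g)
  have h2 := hR.card_add_le.trans (Finset.card_le_univ _)
  have h3 := card_filter_add_card_map_filter ρ A
  rw [Multiset.card_replicate, hg] at h1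
  rw [List.length_append, Multiset.length_toList, Finset.card_one, ← Nat.card_eq_fintype_card] at h2
  omega

theorem exists_long_prod_of_two_generators [Finite G] [DecidableEq Q] {e ε : Q} {i : ℕ}
    (hε : ε ^ 2 = 1) (he : e ^ 2 ^ i = 1) (hgen : ∀ q : Q, ∃ c m : ℕ, q = ε ^ c * e ^ m)
    (hεe : ε ∉ Subgroup.zpowers e) {ρ : G →* Q}
    (hρ : Function.Surjective ρ) {A : Multiset G} (hA : ProductOneFree A)
    (hap : Aperiodic (subsetProds ((A.filter (ρ · ≠ 1)).map ρ))) (B : Multiset Q) {k : ℕ}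
    (hk : davenport G + k ≤ A.card + B.card + 1) :
    ∃ T ≤ B, k ≤ T.card ∧ T.prod⁻¹ ∈ subsetProds ((A.filter (ρ · ≠ 1)).map ρ) := by
  -- The exact order 2^j replaces the exponent 2^i, so that the free sequence `C` has length equal
  -- to the last exponent at which the ideal power may survive.
  obtain ⟨j, -, hj⟩ := (Nat.dvd_prime_pow Nat.prime_two).1 (orderOf_dvd_of_pow_eq_one he)
  have hej : e ^ 2 ^ j = 1 := by rw [← hj, pow_orderOf_eq_one]
  have hC := productOneFree_cons_replicate hεe
  have hpos : 1 ≤ 2 ^ j := Nat.one_le_two_pow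
  have hCcard : (ε ::ₘ Multiset.replicate (orderOf e - 1) e).card = 2 ^ j := by
    rw [Multiset.card_cons, Multiset.card_replicate, hj]
    omega
  have h3 := card_filter_add_card_map_filter ρ A
  by_cases hA' : ProductOneFree ((A.filter (ρ · ≠ 1)).map ρ)
  · have h1 := hA.card_filter_add_card_lt_davenport hρ hC
    have hI := oneSub_mem_generatorIdeal hgen
    obtain ⟨T, hT, hTk, hT1⟩ := exists_coeff_prod_inv_ne_zero hI
      (generatorIdeal_pow_eq_bot hε hej) B _ _ k (prod_oneSub_mem_pow hI _)
      (by rw [coeff_one_prod_oneSub _ hA']; exact one_ne_zero) (by omega)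
    exact ⟨T, hT, hTk, by_contra fun h => hT1 (coeff_prod_oneSub_eq_zero _ _ h)⟩
  · obtain ⟨R, T, hR, hT, hTR, hT1⟩ :=
      exists_strictChain_append_and_prod_inv_mem ne_one_of_mem_map_filter hap B
    refine ⟨T, hT, ?_, hT1⟩
    have hfin : Finite Q := Finite.of_surjective ρ hρ
    have h1 := hA.card_filter_add_card_add_one_lt_davenport hρ hA' hC
    have h2 := hR.length_le_two_pow_add_one hε hej hgen
    rw [List.length_append, Multiset.length_toList] at h2
    omega

/-- Let `π : G → H` be a surjection onto a group which is cyclic, or generated by an involution and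
an element of order a power of two. If `A` in `G` is product-one free and `A` and `B` together have
at least `D(G) + k - 1` elements, then `k` or more elements of `B` together with elements
of `A` have product `1` in `H`. -/
theorem exists_long_prod {H : Type*} [CommGroup H] [DecidableEq H] [Finite G]
    (hH : IsCyclic H ∨ ∃ (e ε : H) (i : ℕ), ε ^ 2 = 1 ∧ e ^ 2 ^ i = 1 ∧
      ∀ q : H, ∃ c m : ℕ, q = ε ^ c * e ^ m)
    {π : G →* H} (hπ : Function.Surjective π) {A : Multiset G} (hA : ProductOneFree A)
    (B : Multiset H) {k : ℕ} (hk : davenport G + k ≤ A.card + B.card + 1) :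
    ∃ T ≤ B, k ≤ T.card ∧ ∃ U ≤ A, π U.prod * T.prod = 1 := by
  classical
  set M := MulAction.stabilizer H (subsetProds (A.map π)) with hM
  let ρ : G →* H ⧸ M := (QuotientGroup.mk' M).comp π
  have hρ : Function.Surjective ρ := (QuotientGroup.mk'_surjective M).comp hπ
  have hpart : (A.filter (ρ · ≠ 1)).map ρ = aperiodicPart (A.map π) := by
    rw [aperiodicPart, Multiset.filter_map, Multiset.map_map]
    congr 1
    refine Multiset.filter_congr fun a _ => ?_
    rw [Function.comp_apply, ← hM, ne_eq, ← QuotientGroup.eq_one_iff]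
    rfl
  have hap : Aperiodic (subsetProds ((A.filter (ρ · ≠ 1)).map ρ)) := by
    rw [hpart]
    exact aperiodic_aperiodicPart _
  have hk' : davenport G + k ≤ A.card + (B.map (QuotientGroup.mk' M)).card + 1 := by
    rwa [Multiset.card_map]
  obtain ⟨T, hT, hTk, hT1⟩ : ∃ T ≤ B.map (QuotientGroup.mk' M), k ≤ T.card ∧
      T.prod⁻¹ ∈ subsetProds ((A.filter (ρ · ≠ 1)).map ρ) := by
    -- The quotient may be cyclic even when `H` is not; if it is not, ε is not a power of e there.
    by_cases hcyc : IsCyclic (H ⧸ M)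
    · exact exists_long_prod_of_isCyclic hρ hA hap _ hk'
    · rcases hH with hH | ⟨e, ε, i, hε, he, hgen⟩
      · exact absurd (isCyclic_of_surjective _ (QuotientGroup.mk'_surjective M)) hcyc
      · have hgen' : ∀ q : H ⧸ M, ∃ c m : ℕ,
            q = QuotientGroup.mk' M ε ^ c * QuotientGroup.mk' M e ^ m := by
          intro q
          obtain ⟨h, rfl⟩ := QuotientGroup.mk'_surjective M q
          obtain ⟨c, m, rfl⟩ := hgen h
          exact ⟨c, m, by simp⟩
        refine exists_long_prod_of_two_generators (i := i) (e := QuotientGroup.mk' M e)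
          (ε := QuotientGroup.mk' M ε) (by rw [← map_pow, hε, map_one])
          (by rw [← map_pow, he, map_one]) hgen' (fun hmem => hcyc ⟨QuotientGroup.mk' M e, ?_⟩)
          hρ hA hap _ hk'
        intro q
        obtain ⟨c, m, rfl⟩ := hgen' q
        exact mul_mem (pow_mem hmem c) (pow_mem (Subgroup.mem_zpowers _) m)
  obtain ⟨T, hTB, rfl⟩ := Multiset.exists_map_eq_of_le_map hT
  rw [← map_multiset_prod, ← map_inv, hpart, mk_mem_subsetProds_aperiodicPart, subsetProds_map,
    Finset.mem_image] at hT1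
  obtain ⟨u, hu, h⟩ := hT1
  obtain ⟨U, hU, rfl⟩ := mem_subsetProds.1 hu
  exact ⟨T, hTB, by simpa using hTk, U, hU, by rw [h, inv_mul_cancel]⟩

end ProductOneFree

/-! ### Units and nonunits modulo prime powers -/

section ZModUnits

/-- The only noncyclic case is 2^l with l ≥ 3: the powers of 5 have index 2, and -1 is not among
them because they are 1 modulo 4. -/
theorem isCyclic_or_two_generators_units_zmod_prime_pow {q : ℕ} (hq : q.Prime) (l : ℕ) :
    IsCyclic (ZMod (q ^ l))ˣ ∨ ∃ (e ε : (ZMod (q ^ l))ˣ) (i : ℕ), ε ^ 2 = 1 ∧ e ^ 2 ^ i = 1 ∧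
      ∀ u : (ZMod (q ^ l))ˣ, ∃ c m : ℕ, u = ε ^ c * e ^ m := by
  by_cases hq2 : q = 2
  swap
  · exact Or.inl (ZMod.isCyclic_units_of_prime_pow q hq hq2 l)
  subst hq2
  rcases Nat.lt_or_ge 2 l with hl | hl
  swap
  · exact Or.inl ((ZMod.isCyclic_units_two_pow_iff l).2 hl)
  obtain ⟨n, rfl⟩ := Nat.exists_eq_add_of_le' hl
  right
  have h5 : IsUnit (5 : ZMod (2 ^ (n + 1 + 2))) := by
    have : IsUnit ((5 : ℕ) : ZMod (2 ^ (n + 1 + 2))) := by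
      rw [ZMod.isUnit_iff_coprime]
      exact Nat.Coprime.pow_right _ (by norm_num)
    exact_mod_cast this
  have hord : orderOf h5.unit = 2 ^ (n + 1) := by
    rw [← orderOf_units, IsUnit.unit_spec, ZMod.orderOf_five]
  have hindex : (Subgroup.zpowers h5.unit).index = 2 := by
    have h1 := Subgroup.card_mul_index (Subgroup.zpowers h5.unit)
    rw [Nat.card_zpowers, hord, Nat.card_eq_fintype_card, ZMod.card_units_eq_totient,
      Nat.totient_prime_pow_succ Nat.prime_two] at h1
    have : 2 ^ (n + 1) * (Subgroup.zpowers h5.unit).index = 2 ^ (n + 1) * 2 := by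
      rw [h1, pow_succ]
      ring
    exact Nat.eq_of_mul_eq_mul_left (by positivity) this
  have hneg : (-1 : (ZMod (2 ^ (n + 1 + 2)))ˣ) ∉ Subgroup.zpowers h5.unit := by
    intro hmem
    have hdvd : 4 ∣ 2 ^ (n + 1 + 2) :=
      Dvd.intro_left (2 ^ (n + 1)) (by rw [pow_add _ (n + 1)]; norm_num)
    have h1 : Subgroup.zpowers h5.unit ≤ (ZMod.unitsMap hdvd).ker := by
      rw [Subgroup.zpowers_le, MonoidHom.mem_ker]
      ext
      change ((ZMod.castHom hdvd (ZMod 4) (h5.unit : ZMod _))) = 1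
      rw [IsUnit.unit_spec, map_ofNat]
      decide
    have h2 : ZMod.castHom hdvd (ZMod 4) ((-1 : (ZMod (2 ^ (n + 1 + 2)))ˣ) : ZMod _) = 1 :=
      congrArg Units.val (MonoidHom.mem_ker.1 (h1 hmem))
    rw [Units.val_neg, Units.val_one, map_neg, map_one] at h2
    exact absurd h2 (by decide)
  refine ⟨h5.unit, -1, n + 1, by simp, by rw [← hord, pow_orderOf_eq_one], fun u => ?_⟩
  have hpow : ∀ v ∈ Subgroup.zpowers h5.unit, ∃ m : ℕ, v = h5.unit ^ m := fun v hv => by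
    obtain ⟨m, hm⟩ := (isOfFinOrder_of_finite h5.unit).mem_powers_iff_mem_zpowers.2 hv
    exact ⟨m, hm.symm⟩
  by_cases hu : u ∈ Subgroup.zpowers h5.unit
  · obtain ⟨m, hm⟩ := hpow u hu
    exact ⟨0, m, by rw [pow_zero, one_mul, hm]⟩
  · obtain ⟨m, hm⟩ := hpow (-1 * u)
      ((Subgroup.mul_mem_iff_of_index_two hindex).2 (iff_of_false hneg hu))
    exact ⟨1, m, by rw [← hm]; simp⟩

theorem prime_dvd_of_not_isUnit {p k : ℕ} (hp : p.Prime) {x : ZMod (p ^ k)} (hx : ¬ IsUnit x) :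
    (p : ZMod (p ^ k)) ∣ x := by
  have : NeZero (p ^ k) := ⟨pow_ne_zero _ hp.ne_zero⟩
  rw [← ZMod.natCast_zmod_val x] at hx ⊢
  rw [ZMod.isUnit_iff_coprime] at hx
  refine Nat.cast_dvd_cast ?_
  by_contra h
  exact hx (((hp.coprime_iff_not_dvd.2 h).symm).pow_right _)

theorem prod_eq_zero_of_not_isUnit {p k : ℕ} (hp : p.Prime) {S : Multiset (ZMod (p ^ k))}
    (hS : ∀ x ∈ S, ¬ IsUnit x) (hk : k ≤ S.card) : S.prod = 0 := by
  have h : (p : ZMod (p ^ k)) ^ S.card ∣ S.prod := by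
    clear hk
    induction S using Multiset.induction with
    | empty => simp
    | cons x S ih =>
      rw [Multiset.card_cons, pow_succ', Multiset.prod_cons]
      exact mul_dvd_mul (prime_dvd_of_not_isUnit hp (hS x (Multiset.mem_cons_self _ _)))
        (ih fun y hy => hS y (Multiset.mem_cons_of_mem hy))
  have h0 : (p : ZMod (p ^ k)) ^ k = 0 := by rw [← Nat.cast_pow, ZMod.natCast_self]
  exact zero_dvd_iff.1 (h0 ▸ (pow_dvd_pow _ hk).trans h)

end ZModUnits

/-! ### The Chinese remainder theorem in terms of reductions -/

section ChineseRemainder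

variable {n r s : ℕ}

theorem chineseRemainder_fst (h : r.Coprime s) (x : ZMod (r * s)) :
    (ZMod.chineseRemainder h x).1 = ZMod.castHom (dvd_mul_right r s) (ZMod r) x :=
  RingHom.congr_fun (RingHom.ext_zmod ((RingHom.fst _ _).comp (ZMod.chineseRemainder h).toRingHom)
    (ZMod.castHom (dvd_mul_right r s) (ZMod r))) x

theorem chineseRemainder_snd (h : r.Coprime s) (x : ZMod (r * s)) :
    (ZMod.chineseRemainder h x).2 = ZMod.castHom (dvd_mul_left s r) (ZMod s) x :=
  RingHom.congr_fun (RingHom.ext_zmod ((RingHom.snd _ _).comp (ZMod.chineseRemainder h).toRingHom)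
    (ZMod.castHom (dvd_mul_left s r) (ZMod s))) x

theorem castHom_ext_of_coprime (hn : n = r * s) (h : r.Coprime s) {x y : ZMod n}
    (h1 : ZMod.castHom (hn ▸ dvd_mul_right r s) (ZMod r) x =
      ZMod.castHom (hn ▸ dvd_mul_right r s) (ZMod r) y)
    (h2 : ZMod.castHom (hn ▸ dvd_mul_left s r) (ZMod s) x =
      ZMod.castHom (hn ▸ dvd_mul_left s r) (ZMod s) y) : x = y := by
  subst hn
  apply (ZMod.chineseRemainder h).injective
  exact Prod.ext (by rw [chineseRemainder_fst, chineseRemainder_fst, h1])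
    (by rw [chineseRemainder_snd, chineseRemainder_snd, h2])

theorem exists_castHom_eq_of_coprime (hn : n = r * s) (h : r.Coprime s) (a : ZMod r) (b : ZMod s) :
    ∃ x : ZMod n, ZMod.castHom (hn ▸ dvd_mul_right r s) (ZMod r) x = a ∧
      ZMod.castHom (hn ▸ dvd_mul_left s r) (ZMod s) x = b := by
  subst hn
  obtain ⟨x, hx⟩ := (ZMod.chineseRemainder h).surjective (a, b)
  exact ⟨x, (chineseRemainder_fst h x).symm.trans (congrArg Prod.fst hx),
    (chineseRemainder_snd h x).symm.trans (congrArg Prod.snd hx)⟩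

theorem isUnit_iff_castHom_of_coprime (hn : n = r * s) (h : r.Coprime s) {x : ZMod n} :
    IsUnit x ↔ IsUnit (ZMod.castHom (hn ▸ dvd_mul_right r s) (ZMod r) x) ∧
      IsUnit (ZMod.castHom (hn ▸ dvd_mul_left s r) (ZMod s) x) := by
  refine ⟨fun hx => ⟨hx.map _, hx.map _⟩, fun ⟨h1, h2⟩ => ?_⟩
  obtain ⟨a, ha⟩ := h1.exists_right_inv
  obtain ⟨b, hb⟩ := h2.exists_right_inv
  obtain ⟨y, rfl, rfl⟩ := exists_castHom_eq_of_coprime hn h a b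
  refine IsUnit.of_mul_eq_one y (castHom_ext_of_coprime hn h ?_ ?_)
  · rw [map_mul, map_one, ha]
  · rw [map_mul, map_one, hb]

end ChineseRemainder

/-! ### The two bounds for the Erdős–Burgess constant -/

section ErdosBurgess

theorem Multiset.exists_map_eq_of_forall_mem {α β : Type*} {f : α → β} {S : Multiset β}
    (h : ∀ b ∈ S, ∃ a, f a = b) : ∃ U : Multiset α, U.map f = S := by
  choose g hg using h
  refine ⟨S.pmap g fun _ => id, ?_⟩
  rw [Multiset.map_pmap]
  exact (Multiset.pmap_congr _ fun b hb _ _ => hg b hb).trans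
    ((Multiset.pmap_eq_map _ id _ fun _ => id).trans (Multiset.map_id _))

/-- Unless units alone give product 1, the idempotent found is 0 modulo p^k, thanks to at least k
factors divisible by p, and 1 modulo q^l. -/
theorem exists_idempotent_prod_of_coprime {n p k q l : ℕ} (hp : p.Prime) (hq : q.Prime)
    (hpq : p ≠ q) (hk : 1 ≤ k) (hn : n = p ^ k * q ^ l) (S : Multiset (ZMod n))
    [DecidablePred (IsUnit : ZMod n → Prop)] [Finite (ZMod n)ˣ]
    [DecidablePred fun x : ZMod n => ¬ IsUnit x ∧
      IsUnit (ZMod.castHom (hn ▸ dvd_mul_left (q ^ l) (p ^ k)) (ZMod (q ^ l)) x)]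
    (hS : davenport (ZMod n)ˣ + k ≤ (S.filter IsUnit).card +
      (S.filter fun x => ¬ IsUnit x ∧
        IsUnit (ZMod.castHom (hn ▸ dvd_mul_left (q ^ l) (p ^ k)) (ZMod (q ^ l)) x)).card + 1) :
    ∃ T ≤ S, T ≠ 0 ∧ IsIdempotentElem T.prod := by
  classical
  have hco : (p ^ k).Coprime (q ^ l) := ((Nat.coprime_primes hp hq).2 hpq).pow k l
  have hn0 : NeZero n := ⟨by
    rw [hn]
    exact mul_ne_zero (pow_ne_zero _ hp.ne_zero) (pow_ne_zero _ hq.ne_zero)⟩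
  have hdp : p ^ k ∣ n := hn ▸ dvd_mul_right _ _
  have hdq : q ^ l ∣ n := hn ▸ dvd_mul_left _ _
  obtain ⟨A, hA⟩ : ∃ A : Multiset (ZMod n)ˣ, A.map Units.val = S.filter IsUnit :=
    Multiset.exists_map_eq_of_forall_mem fun b hb => (Multiset.mem_filter.1 hb).2
  by_cases hfree : ProductOneFree A
  swap
  · simp only [ProductOneFree, not_forall] at hfree
    obtain ⟨T, hT, hT1, hT0⟩ := hfree
    refine ⟨T.map Units.val, ?_, by simpa using hT0, ?_⟩
    · exact (Multiset.map_le_map hT).trans (hA ▸ Multiset.filter_le _ _)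
    · have : (T.map Units.val).prod = 1 := by
        rw [← Units.val_one, ← hT1]
        exact (map_multiset_prod (Units.coeHom (ZMod n)) T).symm
      rw [this]
      exact IsIdempotentElem.one
  let P : ZMod n → Prop := fun x => ¬ IsUnit x ∧ IsUnit (ZMod.castHom hdq (ZMod (q ^ l)) x)
  -- The default 1 is never met on elements satisfying `P`.
  let u : ZMod n → (ZMod (q ^ l))ˣ := fun x =>
    if h : IsUnit (ZMod.castHom hdq (ZMod (q ^ l)) x) then h.unit else 1
  have hu : ∀ x ∈ S.filter P, ((u x : (ZMod (q ^ l))ˣ) : ZMod (q ^ l)) =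
      ZMod.castHom hdq (ZMod (q ^ l)) x := by
    intro x hx
    simp only [u]
    rw [dif_pos (Multiset.mem_filter.1 hx).2.2, IsUnit.unit_spec]
  have hA' : A.card = (S.filter IsUnit).card := by rw [← hA, Multiset.card_map]
  obtain ⟨T, hT, hTk, U, hU, hUT⟩ := exists_long_prod
    (isCyclic_or_two_generators_units_zmod_prime_pow hq l) (ZMod.unitsMap_surjective hdq) hfree
    ((S.filter P).map u) (k := k) (by rw [Multiset.card_map, hA']; convert hS)
  obtain ⟨T, hTS, rfl⟩ := Multiset.exists_map_eq_of_le_map hT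
  rw [Multiset.card_map] at hTk
  have hq1 : ZMod.castHom hdq (ZMod (q ^ l)) (U.map Units.val + T).prod = 1 := by
    have h1 : ZMod.castHom hdq (ZMod (q ^ l)) (U.prod : ZMod n) *
        ((T.map u).prod : (ZMod (q ^ l))ˣ) = 1 := congrArg Units.val hUT
    rw [Multiset.prod_add, map_mul, ← h1]
    congr 1
    · exact congrArg _ (map_multiset_prod (Units.coeHom (ZMod n)) U).symm
    · rw [map_multiset_prod]
      refine Eq.trans ?_ (map_multiset_prod (Units.coeHom (ZMod (q ^ l))) _).symm
      rw [Multiset.map_map]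
      exact congrArg _ (Multiset.map_congr rfl fun x hx => (hu x (Multiset.mem_of_le hTS hx)).symm)
  have hp0 : ZMod.castHom hdp (ZMod (p ^ k)) (U.map Units.val + T).prod = 0 := by
    rw [Multiset.prod_add, map_mul, map_multiset_prod _ T, prod_eq_zero_of_not_isUnit hp _
      (by rwa [Multiset.card_map]), mul_zero]
    intro y hy
    obtain ⟨x, hx, rfl⟩ := Multiset.mem_map.1 hy
    have := (Multiset.mem_filter.1 (Multiset.mem_of_le hTS hx)).2
    exact fun h => this.1 ((isUnit_iff_castHom_of_coprime hn hco).2 ⟨h, this.2⟩)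
  refine ⟨U.map Units.val + T, ?_, ?_, castHom_ext_of_coprime hn hco ?_ ?_⟩
  · rw [← Multiset.filter_add_not IsUnit S]
    refine add_le_add (hA ▸ Multiset.map_le_map hU) (hTS.trans ?_)
    exact Multiset.monotone_filter_right S fun x hx => hx.1
  · intro h0
    rw [add_eq_zero] at h0
    rw [h0.2, Multiset.card_zero] at hTk
    omega
  · rw [map_mul, hp0, mul_zero]
  · rw [map_mul, hq1, mul_one]

variable {n p k q l : ℕ}

theorem isErdosBurgessLength_zmod (hp : p.Prime) (hq : q.Prime) (hpq : p ≠ q) (hk : 1 ≤ k)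
    (hl : 1 ≤ l) (hn : n = p ^ k * q ^ l) [Finite (ZMod n)ˣ] :
    IsErdosBurgessLength (ZMod n)
      (davenport (ZMod n)ˣ + (k - 1) + (l - 1)) := by
  classical
  rw [isErdosBurgessLength_iff]
  intro L hL
  suffices h : ∃ T ≤ (L : Multiset (ZMod n)), T ≠ 0 ∧ IsIdempotentElem T.prod by
    obtain ⟨T, hT, hT0, hT1⟩ := h
    induction T using Quotient.inductionOn with
    | h T =>
      obtain ⟨T', hT', hs⟩ := Multiset.coe_le.1 hT
      refine ⟨T', ?_, hs, ?_⟩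
      · rintro rfl
        exact hT0 (by simpa using hT'.symm)
      · rw [hT'.prod_eq]
        simpa using hT1
  have hco : (p ^ k).Coprime (q ^ l) := ((Nat.coprime_primes hp hq).2 hpq).pow k l
  have hn' : n = q ^ l * p ^ k := hn.trans (mul_comm _ _)
  set S : Multiset (ZMod n) := Multiset.ofList L with hS
  let f := ZMod.castHom (hn ▸ dvd_mul_right (p ^ k) (q ^ l) : p ^ k ∣ n) (ZMod (p ^ k))
  let g := ZMod.castHom (hn ▸ dvd_mul_left (q ^ l) (p ^ k) : q ^ l ∣ n) (ZMod (q ^ l))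
  have hcard : (S.filter IsUnit).card + (S.filter fun x => ¬ IsUnit x).card = S.card := by
    rw [← Multiset.card_add, Multiset.filter_add_not]
  have hcardf : (S.filter fun x => ¬ IsUnit x ∧ IsUnit (f x)).card +
      (S.filter fun x => ¬ IsUnit (f x)).card = (S.filter fun x => ¬ IsUnit x).card := by
    rw [← Multiset.filter_add_not (fun x => IsUnit (f x)) (S.filter fun x => ¬ IsUnit x),
      Multiset.card_add, Multiset.filter_filter, Multiset.filter_filter]
    congr 2
    · exact Multiset.filter_congr fun x _ => and_comm
    · refine Multiset.filter_congr fun x _ => ⟨fun h => ⟨h, fun hx => h (hx.map f)⟩, fun h => h.1⟩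
  have hcardg : (S.filter fun x => ¬ IsUnit x ∧ IsUnit (g x)).card +
      (S.filter fun x => ¬ IsUnit (g x)).card = (S.filter fun x => ¬ IsUnit x).card := by
    rw [← Multiset.filter_add_not (fun x => IsUnit (g x)) (S.filter fun x => ¬ IsUnit x),
      Multiset.card_add, Multiset.filter_filter, Multiset.filter_filter]
    congr 2
    · exact Multiset.filter_congr fun x _ => and_comm
    · refine Multiset.filter_congr fun x _ => ⟨fun h => ⟨h, fun hx => h (hx.map g)⟩, fun h => h.1⟩
  have hSL : S.card = davenport (ZMod n)ˣ + (k - 1) + (l - 1) := hL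
  by_cases hg : (S.filter fun x => ¬ IsUnit (g x)).card < l
  · refine exists_idempotent_prod_of_coprime hp hq hpq hk hn S ?_
    change _ ≤ _ + (S.filter fun x => ¬ IsUnit x ∧ IsUnit (g x)).card + 1
    omega
  by_cases hf : (S.filter fun x => ¬ IsUnit (f x)).card < k
  · refine exists_idempotent_prod_of_coprime hq hp hpq.symm hl hn' S ?_
    change _ ≤ _ + (S.filter fun x => ¬ IsUnit x ∧ IsUnit (f x)).card + 1
    omega
  -- Now at least k terms are divisible by p and at least l by q, so the product of all nonunits is
  -- 0.
  have hf0 : f (S.filter fun x => ¬ IsUnit x).prod = 0 := by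
    obtain ⟨U, hU⟩ := Multiset.le_iff_exists_add.1 (Multiset.monotone_filter_right S
      (fun x (h : ¬ IsUnit (f x)) => show ¬ IsUnit x from fun hx => h (hx.map f)))
    rw [hU, Multiset.prod_add, map_mul, map_multiset_prod, prod_eq_zero_of_not_isUnit hp _
      (by rw [Multiset.card_map]; omega), zero_mul]
    intro y hy
    obtain ⟨x, hx, rfl⟩ := Multiset.mem_map.1 hy
    exact (Multiset.mem_filter.1 hx).2
  have hg0 : g (S.filter fun x => ¬ IsUnit x).prod = 0 := by
    obtain ⟨U, hU⟩ := Multiset.le_iff_exists_add.1 (Multiset.monotone_filter_right S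
      (fun x (h : ¬ IsUnit (g x)) => show ¬ IsUnit x from fun hx => h (hx.map g)))
    rw [hU, Multiset.prod_add, map_mul, map_multiset_prod, prod_eq_zero_of_not_isUnit hq _
      (by rw [Multiset.card_map]; omega), zero_mul]
    intro y hy
    obtain ⟨x, hx, rfl⟩ := Multiset.mem_map.1 hy
    exact (Multiset.mem_filter.1 hx).2
  refine ⟨S.filter fun x => ¬ IsUnit x, Multiset.filter_le _ _, fun h0 => ?_,
    castHom_ext_of_coprime hn hco ?_ ?_⟩
  · rw [h0, Multiset.card_zero] at hcardf
    omega
  · change f _ = f _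
    rw [map_mul, hf0, mul_zero]
  · change g _ = g _
    rw [map_mul, hg0, mul_zero]

/-- An idempotent equals its powers; for i > 0 this one is nilpotent, hence 0, which i < k forbids.
-/
theorem eq_zero_of_isIdempotentElem_isUnit_mul_pow (hp : p.Prime) (hk : 1 ≤ k) {u : ZMod (p ^ k)}
    (hu : IsUnit u) {i : ℕ} (hi : i < k) (h : IsIdempotentElem (u * (p : ZMod (p ^ k)) ^ i)) :
    i = 0 := by
  by_contra hi0
  obtain ⟨k, rfl⟩ := Nat.exists_eq_add_of_le' hk
  have h1 := h.pow_succ_eq k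
  have h2 : (u * (p : ZMod (p ^ (k + 1))) ^ i) ^ (k + 1) = 0 := by
    rw [mul_pow, ← pow_mul, mul_comm i, pow_mul, ← Nat.cast_pow, ZMod.natCast_self, zero_pow hi0,
      mul_zero]
  rw [h2, eq_comm, hu.mul_right_eq_zero, ← Nat.cast_pow, ZMod.natCast_eq_zero_iff] at h1
  have := (Nat.pow_dvd_pow_iff_le_right hp.one_lt).1 h1
  omega

theorem le_of_isErdosBurgessLength_zmod (hp : p.Prime) (hq : q.Prime) (hpq : p ≠ q) (hk : 1 ≤ k)
    (hl : 1 ≤ l) (hn : n = p ^ k * q ^ l) [Finite (ZMod n)ˣ] {m : ℕ}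
    (hm : IsErdosBurgessLength (ZMod n) m) :
    davenport (ZMod n)ˣ + (k - 1) + (l - 1) ≤ m := by
  have hco : (p ^ k).Coprime (q ^ l) := ((Nat.coprime_primes hp hq).2 hpq).pow k l
  rw [isErdosBurgessLength_iff] at hm
  let f := ZMod.castHom (hn ▸ dvd_mul_right (p ^ k) (q ^ l) : p ^ k ∣ n) (ZMod (p ^ k))
  let g := ZMod.castHom (hn ▸ dvd_mul_left (q ^ l) (p ^ k) : q ^ l ∣ n) (ZMod (q ^ l))
  obtain ⟨x, hx1, hx2⟩ : ∃ x : ZMod n, f x = p ∧ g x = 1 := exists_castHom_eq_of_coprime hn hco _ _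
  obtain ⟨y, hy1, hy2⟩ : ∃ y : ZMod n, f y = 1 ∧ g y = q := exists_castHom_eq_of_coprime hn hco _ _
  obtain ⟨A, hA, hfree⟩ := exists_productOneFree_card (G := (ZMod n)ˣ)
  by_contra! hlt
  -- The full sequence has length D - 1 + (k - 1) + (l - 1); it is truncated to `m` terms, and
  -- subsequences of the prefix suffice.
  obtain ⟨T, hT0, hT, hT1⟩ := hm ((A.map Units.val ++ (List.replicate (k - 1) x ++
    List.replicate (l - 1) y)).take m) (by
      rw [List.length_take, List.length_append, List.length_append, List.length_map,
        List.length_replicate, List.length_replicate]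
      exact min_eq_left (by omega))
  obtain ⟨T₁, T₂, rfl, hs₁, hs₂⟩ := List.sublist_append_iff.1 (hT.trans (List.take_sublist _ _))
  obtain ⟨T₂, T₃, rfl, hs₂, hs₃⟩ := List.sublist_append_iff.1 hs₂
  obtain ⟨B, hB, rfl⟩ := List.sublist_map_iff.1 hs₁
  obtain ⟨i, hi, rfl⟩ := List.sublist_replicate_iff.1 hs₂
  obtain ⟨j, hj, rfl⟩ := List.sublist_replicate_iff.1 hs₃
  have hBprod : (B.map Units.val).prod = (B.prod : ZMod n) :=
    (map_list_prod (Units.coeHom (ZMod n)) B).symm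
  rw [List.prod_append, List.prod_append, List.prod_replicate, List.prod_replicate, hBprod] at hT1
  have hi0 : i = 0 := by
    have h := hT1.map f
    rw [map_mul, map_mul, map_pow, map_pow, hx1, hy1, one_pow, mul_one] at h
    exact eq_zero_of_isIdempotentElem_isUnit_mul_pow hp hk (B.prod.isUnit.map f) (by omega) h
  have hj0 : j = 0 := by
    have h := hT1.map g
    rw [map_mul, map_mul, map_pow, map_pow, hx2, hy2, one_pow, one_mul] at h
    exact eq_zero_of_isIdempotentElem_isUnit_mul_pow hq hl (B.prod.isUnit.map g) (by omega) h
  subst hi0 hj0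
  rw [pow_zero, pow_zero, mul_one, mul_one] at hT1
  have hB1 : B.prod = 1 := by
    have : B.prod * B.prod = B.prod := Units.ext hT1
    simpa using this
  have := hfree B hB.subperm (by simpa using hB1)
  rw [Multiset.coe_eq_zero] at this
  subst this
  simp at hT0

theorem erdosBurgess_zmod (hp : p.Prime) (hq : q.Prime) (hpq : p ≠ q) (hk : 1 ≤ k)
    (hl : 1 ≤ l) (hn : n = p ^ k * q ^ l) [Finite (ZMod n)ˣ] : erdosBurgess (ZMod n) =
      ((davenport (ZMod n)ˣ + (k - 1) + (l - 1) : ℕ) : ℕ∞) := by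
  have hpos := (davenport_isLeast (ZMod n)ˣ).1.1
  refine le_antisymm (sInf_le ⟨_, by omega, isErdosBurgessLength_zmod hp hq hpq hk hl hn, rfl⟩)
    (le_sInf ?_)
  rintro _ ⟨m, -, hm, rfl⟩
  exact_mod_cast le_of_isErdosBurgessLength_zmod hp hq hpq hk hl hn hm

theorem exists_eq_prime_pow_mul_prime_pow {n : ℕ}
    (hn : ArithmeticFunction.cardDistinctFactors n = 2) :
    ∃ p q k l : ℕ, p.Prime ∧ q.Prime ∧ p ≠ q ∧ 1 ≤ k ∧ 1 ≤ l ∧ n = p ^ k * q ^ l := by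
  have hn0 : n ≠ 0 := by
    rintro rfl
    simp at hn
  have hcard : n.primeFactors.card = 2 := by
    rw [← hn, ArithmeticFunction.cardDistinctFactors_apply]
    rfl
  obtain ⟨p, q, hpq, h⟩ := Finset.card_eq_two.1 hcard
  have hp : p ∈ n.primeFactors := by simp [h]
  have hq : q ∈ n.primeFactors := by simp [h]
  refine ⟨p, q, n.factorization p, n.factorization q, Nat.prime_of_mem_primeFactors hp,
    Nat.prime_of_mem_primeFactors hq, hpq, ?_, ?_, ?_⟩
  · exact (Nat.prime_of_mem_primeFactors hp).factorization_pos_of_dvd hn0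
      (Nat.dvd_of_mem_primeFactors hp)
  · exact (Nat.prime_of_mem_primeFactors hq).factorization_pos_of_dvd hn0
      (Nat.dvd_of_mem_primeFactors hq)
  · conv_lhs => rw [← Nat.prod_factorization_pow_eq_self hn0]
    rw [Finsupp.prod, Nat.support_factorization, h, Finset.prod_pair hpq]

end ErdosBurgess

theorem theorem1p3 :
    (∀ (p q k l : ℕ), p.Prime → q.Prime → p ≠ q → 1 ≤ k → 1 ≤ l →
      erdosBurgess (ZMod (p ^ k * q ^ l)) =
        ((davenport (ZMod (p ^ k * q ^ l))ˣ + (k - 1) + (l - 1) : ℕ) : ℕ∞)) ∧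
    (∀ n : ℕ, ArithmeticFunction.cardDistinctFactors n = 2 →
      erdosBurgess (ZMod n) =
        ((davenport (ZMod n)ˣ + (ArithmeticFunction.cardFactors n -
          ArithmeticFunction.cardDistinctFactors n) : ℕ) : ℕ∞)) := by
  refine ⟨fun p q k l hp hq hpq hk hl => erdosBurgess_zmod hp hq hpq hk hl rfl, fun n hn => ?_⟩
  rw [hn]
  obtain ⟨p, q, k, l, hp, hq, hpq, hk, hl, rfl⟩ := exists_eq_prime_pow_mul_prime_pow hn
  rw [erdosBurgess_zmod hp hq hpq hk hl rfl, ArithmeticFunction.cardFactors_mul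
    (pow_ne_zero _ hp.ne_zero) (pow_ne_zero _ hq.ne_zero),
    ArithmeticFunction.cardFactors_apply_prime_pow hp,
    ArithmeticFunction.cardFactors_apply_prime_pow hq]
  congr 1
  omega
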